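/- Let $K$ be a $p$-adic field, i.e. $[K:\mathbb{Q}_p]<\infty$, with valuation ring $R_K$, a fixed uniformizer $\pi$, residue field of cardinality $q$, and absolute value $|z|_K=q^{-\mathrm{ord}(z)}$. Let $|dx|$ be the Haar measure on $K^n$ for which $R_K^n$ has measure $1$. For a quasicharacter $\omega$ of $K^\times$ (a continuous homomorphism $K^\times\to\mathbb{C}^\times$) let $\sigma(\omega)=\mathrm{Re}(s)$, where $\omega(\pi)=q^{-s}$, and let $\Omega_0(K^\times)$ be the set of quasicharacters with $\sigma(\omega)>0$. Let $2\le l\le n$ and $m=n-l+1\ge 1$, let $U\subseteq K^n$ be open and compact, and let $f_1,\ldots,f_l\in K[[x_1,\ldots,x_n]]$ be power series that converge at every point of $U$. Assume that $$V^{(l-1)}=\{x\in U : f_1(x)=\cdots=f_{l-1}(x)=0\}$$ is non-empty and that the Jacobian matrix $(\partial f_i/\partial x_j(x))_{1\le i\le l-1,\,1\le j\le n}$ has rank $l-1$ for every $x\in V^{(l-1)}$, so that $V^{(l-1)}$ is a closed $K$-analytic submanifold of $U$ of dimension $m$. Assume that $f_l$ is not identically zero on $V^{(l-1)}$ and has a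 zero on $V^{(l-1)}$. Let $\gamma_{GL}$ be a Gel'fand–Leray form on $V^{(l-1)}$, i.e. an analytic differential form of degree $m$, defined near $V^{(l-1)}$, with $\gamma_{GL}\wedge df_1\wedge\cdots\wedge df_{l-1}=dx_1\wedge\cdots\wedge dx_n$ at the points of $V^{(l-1)}$, and let $|\gamma_{GL}|$ be the measure that it induces on $V^{(l-1)}$: in a chart in which the restriction of $\gamma_{GL}$ to $V^{(l-1)}$ is $g(y)\,dy_1\wedge\cdots\wedge dy_m$, it is $|g(y)|_K\,|dy|$. Let $\Phi:K^n\to\mathbb{C}$ be a Bruhat–Schwartz function (locally constant with compact support) with support in $U$. For $r\in\mathbb{N}$ let $\delta_r:K^{l-1}\to\mathbb{R}$ be equal to $q^{r(l-1)}$ on $(\pi^rR_K)^{l-1}$ and to $0$ elsewhere. Then for every $\omega\in\Omega_0(K^\times)$ the integral $$Z_\Phi(\omega,V^{(l-1)},f_l)=\int_{V^{(l-1)}\smallsetminus f_l^{-1}(0)}\Phi(x)\,\omega(f_l(x))\,|\gamma_{GL}|$$ converges absolutely, the integrals on the right-hand side below converge absolutely for every $r$ (with $\omega(0)$ read as $0$),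 and $$Z_\Phi(\omega,V^{(l-1)},f_l)=\lim_{r\to+\infty}\int_{K^n}\Phi(x)\,\delta_r(f_1(x),\ldots,f_{l-1}(x))\,\omega(f_l(x))\,|dx|.$$ -/

import Mathlib

open MeasureTheory Filter Topology
open scoped ENNReal

noncomputable section

namespace PadicZeta

/-! ### The valuation ring, its residue field, quasicharacters -/

section Field

variable (K : Type*) [NontriviallyNormedField K] [IsUltrametricDist K]

/-- The valuation ring `R_K = {z | ‖z‖ ≤ 1}`. -/
abbrev RK : ValuationSubring K := (NormedField.valuation (K := K)).valuationSubring

/-- The cardinality `q` of the residue field `R_K / P_K`. -/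
def q : ℕ := Nat.card (IsLocalRing.ResidueField (RK K))

variable {K}

/-- A quasicharacter `ω` of `Kˣ`, as a function on `K` (with the value `0` at `0`, so that
`ω (f x)` can be written for every `x`). -/
def quasiVal (ω : Kˣ →ₜ* ℂˣ) (z : K) : ℂ :=
  open Classical in if h : z = 0 then 0 else (ω (Units.mk0 z h) : ℂ)

/-- The exponent `σ(ω) = Re s`, where `ω(π) = q ^ (-s)`. -/
def quasiExponent (π : RK K) (ω : Kˣ →ₜ* ℂˣ) : ℝ :=
  -Real.logb (q K) ‖quasiVal ω (π : K)‖

/-- `Ω_σ(Kˣ)`: the quasicharacters of exponent larger than `σ`. -/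
def Omega (π : RK K) (σ : ℝ) : Set (Kˣ →ₜ* ℂˣ) := {ω | σ < quasiExponent π ω}

/-- `δ_r` on `K ^ k`: the value `q ^ (r k)` on `(π ^ r R_K) ^ k`, and `0` elsewhere. -/
def deltaApprox {k : ℕ} (π : RK K) (r : ℕ) (u : Fin k → K) : ℂ :=
  open Classical in
  if ∀ i, ∃ a : RK K, u i = (π : K) ^ r * (a : K) then (q K : ℂ) ^ (r * k) else 0

end Field

/-! ### Power series -/

section PowerSeries

variable {K : Type*} [NontriviallyNormedField K] {n : ℕ}

/-- The formal power series `f` converges at every point of `U`. -/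
def ConvergesOn (f : MvPowerSeries (Fin n) K) (U : Set (Fin n → K)) : Prop :=
  ∀ x ∈ U, Summable fun α : Fin n →₀ ℕ => MvPowerSeries.coeff α f * ∏ i, x i ^ α i

/-- The sum of the power series `f` at the point `x`. -/
def psum (f : MvPowerSeries (Fin n) K) (x : Fin n → K) : K :=
  ∑' α : Fin n →₀ ℕ, MvPowerSeries.coeff α f * ∏ i, x i ^ α i

/-- The map `x ↦ (f_1(x), …, f_k(x))`. -/
def pmap {k : ℕ} (f : Fin k → MvPowerSeries (Fin n) K) (x : Fin n → K) : Fin k → K :=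
  fun i => psum (f i) x

/-- The set of common zeros in `U` of `f_1, …, f_k`. -/
def zeroLocus {k : ℕ} (f : Fin k → MvPowerSeries (Fin n) K) (U : Set (Fin n → K)) :
    Set (Fin n → K) :=
  {x ∈ U | ∀ i, psum (f i) x = 0}

/-- The Jacobian matrix `(∂ f_i / ∂ x_j (x))`. -/
def jacobian {k : ℕ} (f : Fin k → MvPowerSeries (Fin n) K) (x : Fin n → K) :
    Matrix (Fin k) (Fin n) K :=
  Matrix.of fun i j => fderiv K (psum (f i)) x (Pi.single j 1)

end PowerSeries

/-! ### Differential forms and the measure that a form of top degree induces on a submanifold -/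

section Forms

variable {K : Type*} [NontriviallyNormedField K]

/-- The exterior product of alternating forms (a sum over shuffles, so that
`dx_1 ∧ ⋯ ∧ dx_n` takes the value `1` at the standard basis). -/
def wedge {n m k : ℕ} (α : (Fin n → K) [⋀^Fin m]→ₗ[K] K) (β : (Fin n → K) [⋀^Fin k]→ₗ[K] K) :
    (Fin n → K) [⋀^Fin (m + k)]→ₗ[K] K :=
  ((LinearMap.mul' K K).compAlternatingMap (α.domCoprod β)).domDomCongr finSumFinEquiv

/-- The volume form `dx_1 ∧ ⋯ ∧ dx_n` on `K ^ n`. -/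
def volForm (K : Type*) [NontriviallyNormedField K] (n : ℕ) : (Fin n → K) [⋀^Fin n]→ₗ[K] K :=
  Matrix.detRowAlternating

/-- The form `dF_1 ∧ ⋯ ∧ dF_k` at `x`, which is the pullback of `du_1 ∧ ⋯ ∧ du_k` by the
derivative of `F = (F_1, …, F_k)` at `x`. -/
def wedgeDiff {n k : ℕ} (F : (Fin n → K) → Fin k → K) (x : Fin n → K) :
    (Fin n → K) [⋀^Fin k]→ₗ[K] K :=
  (volForm K k).compLinearMap (fderiv K F x : (Fin n → K) →ₗ[K] (Fin k → K))

/-- `γ` is an analytic form of degree `m` near `V` with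
`γ ∧ df_1 ∧ ⋯ ∧ df_k = dx_1 ∧ ⋯ ∧ dx_n` on `V`, where `n = m + k` (a Gel'fand–Leray form). -/
structure IsGelfandLeray {m k : ℕ} (f : Fin k → MvPowerSeries (Fin (m + k)) K)
    (V : Set (Fin (m + k) → K))
    (γ : (Fin (m + k) → K) → (Fin (m + k) → K) [⋀^Fin m]→ₗ[K] K) : Prop where
  analytic : ∀ x ∈ V, ∀ v : Fin m → Fin (m + k) → K, AnalyticAt K (fun z => γ z v) x
  wedge_eq : ∀ x ∈ V, wedge (γ x) (wedgeDiff (pmap f) x) = volForm K (m + k)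

/-- An analytic parametrization of an open subset of `V` (the inverse of a chart of the
`m`-dimensional submanifold `V` of `K ^ n`): an analytic immersion of an open set of `K ^ m`
that is a homeomorphism onto an open subset of `V`. -/
structure Parametrization {n : ℕ} (V : Set (Fin n → K)) (m : ℕ) where
  source : Set (Fin m → K)
  toFun : (Fin m → K) → (Fin n → K)
  isOpen_source : IsOpen source
  analytic : AnalyticOnNhd K toFun source
  immersion : ∀ y ∈ source, Function.Injective (fderiv K toFun y)
  mapsTo : Set.MapsTo toFun source V
  isOpenEmbedding : IsOpenEmbedding fun y : source => (⟨toFun y, mapsTo y.2⟩ : V)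

variable [MeasurableSpace K]

/-- The measure `|Θ|` on the image of one parametrization `φ`: if
`φ^* Θ = g(y) dy_1 ∧ ⋯ ∧ dy_m`, it is the image by `φ` of the measure `|g(y)| |dy|`.
Here `ν` is the Haar measure of `K`, and `|dy|` is its `m`-th power. -/
def Parametrization.measure {n m : ℕ} {V : Set (Fin n → K)} (φ : Parametrization V m)
    (ν : Measure K) (Θ : (Fin n → K) → (Fin n → K) [⋀^Fin m]→ₗ[K] K) : Measure (Fin n → K) :=
  Measure.map φ.toFun
    (((Measure.pi fun _ : Fin m => ν).restrict φ.source).withDensity fun y =>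
      ‖Θ (φ.toFun y) fun i => fderiv K φ.toFun y (Pi.single i 1)‖ₑ)

/-- The measure `|Θ|` induced on the `m`-dimensional submanifold `V` by the form `Θ` of
degree `m`, as a measure on `K ^ n` carried by `V`. The measures of the single parametrizations
agree on overlaps; the measure glued from them is the least measure that dominates
each of them. -/
def formMeasure {n m : ℕ} (ν : Measure K) (V : Set (Fin n → K))
    (Θ : (Fin n → K) → (Fin n → K) [⋀^Fin m]→ₗ[K] K) : Measure (Fin n → K) :=
  ⨆ φ : Parametrization V m, φ.measure ν Θ

/-- The local zeta function: the integral of `Φ(x) ω(g(x))` over `V` minus the zeros of `g`,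
for the measure `|Θ|`. -/
def zetaFun {n m : ℕ} (ν : Measure K) (Φ : (Fin n → K) → ℂ) (ω : Kˣ →ₜ* ℂˣ)
    (V : Set (Fin n → K)) (g : MvPowerSeries (Fin n) K)
    (Θ : (Fin n → K) → (Fin n → K) [⋀^Fin m]→ₗ[K] K) : ℂ :=
  ∫ x in V \ {x | psum g x = 0}, Φ x * quasiVal ω (psum g x) ∂(formMeasure ν V Θ)

end Forms

end PadicZeta

end

/-! Since `σ(ω) > 0`, the function `ω`, extended by `0`, is continuous at `0`
(`continuous_quasiVal`). So `h = Φ · ω(f_l)` is continuous, with compact support in `U`, and the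
zeros of `f_l` play no special role. What remains is a weak limit: the measures `δ_r(F(x)) |dx|`,
with `F = (f_1, …, f_{l-1})`, converge on compact open sets to `|γ_GL|` when tested against
continuous functions.

The local step is `exists_straightening`. Let `φ` parametrize `V` near `φ(y₀)`, let `T` be its
derivative at `y₀`, and let `s` be a linear section of the derivative of `F` at `φ(y₀)`. Put `Ψ(y,
u) = φ(y) + s(u)` and `L(y, u) = T y + s u`. Strict differentiability makes `L⁻¹ ∘ Ψ` close to the
identity on a small ball. In an ultrametric space it is then an isometry between balls of equal
radius and preserves Haar measure, so `Ψ` scales it by `|D|`, where `D = det L`. In the same way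
`F(Ψ(y, u))` is close to `u`, hence has the same norm. As `δ_r` depends only on the norm, the
integral becomes `|D| ∬ h(Ψ(y, u)) δ_r(u) du dy`, which tends to `|D| ∫ h(φ(y)) dy`. The
Gel'fand–Leray identity, evaluated on the columns of `L`, gives `γ(T e_1, …, T e_m) = D`
(`IsGelfandLeray.apply_eq`), and the norm of this density is locally constant. This is
`Parametrization.exists_local_limit`.

The approximating measures do not mention the chart, so uniqueness of limits also shows that two
parametrizations induce the same measure on an overlap. This replaces a change of variables formula
and identifies `formMeasure` locally (`formMeasure_restrict`). Compactness and disjoint clopen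
pieces then give the global statement. -/

namespace PadicZeta

set_option linter.unusedSectionVars false

/-! ### Uniformizers, quasicharacters and the Haar measure of balls. -/

section FieldLemmas

variable {K : Type*} [NontriviallyNormedField K] [IsUltrametricDist K]

theorem mem_RK {z : K} : z ∈ RK K ↔ ‖z‖ ≤ 1 := Iff.rfl

theorem coe_RK : (RK K : Set K) = Metric.closedBall 0 1 := by
  ext z
  rw [mem_closedBall_zero_iff]
  exact mem_RK

theorem isUnit_RK_iff {z : RK K} : IsUnit z ↔ ‖(z : K)‖ = 1 := by
  constructor
  · rintro ⟨u, rfl⟩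
    have h1 : ‖((u : RK K) : K)‖ ≤ 1 := mem_RK.1 (u : RK K).2
    have h2 : ‖((u⁻¹ : (RK K)ˣ) : K)‖ ≤ 1 := mem_RK.1 ((u⁻¹ : (RK K)ˣ) : RK K).2
    have h3 : ‖((u : RK K) : K)‖ * ‖((u⁻¹ : (RK K)ˣ) : K)‖ = 1 := by
      rw [← norm_mul]
      have : ((u : RK K) : K) * ((u⁻¹ : (RK K)ˣ) : K) = 1 := congrArg Subtype.val u.mul_inv
      rw [this, norm_one]
    nlinarith [norm_nonneg ((u : RK K) : K)]
  · intro h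
    have h0 : (z : K) ≠ 0 := by
      intro h0; simp [h0] at h
    refine IsUnit.of_mul_eq_one ⟨(z : K)⁻¹, mem_RK.2 (by simp [h])⟩ ?_
    ext
    simp [h0]

variable {π : RK K}

theorem uniformizer_ne_zero (hπ : Irreducible π) : (π : K) ≠ 0 := by
  simpa using hπ.ne_zero

theorem norm_uniformizer_pos (hπ : Irreducible π) : 0 < ‖(π : K)‖ :=
  norm_pos_iff.2 (uniformizer_ne_zero hπ)

theorem norm_uniformizer_lt_one (hπ : Irreducible π) : ‖(π : K)‖ < 1 :=
  lt_of_le_of_ne (mem_RK.1 π.2) fun h => hπ.not_isUnit (isUnit_RK_iff.2 h)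

/-- If `‖π‖ < ‖z‖ < 1`, then `π = z · (π / z)` would factor the irreducible `π` into two nonunits.
-/
theorem norm_le_uniformizer (hπ : Irreducible π) {z : K} (hz : ‖z‖ < 1) :
    ‖z‖ ≤ ‖(π : K)‖ := by
  by_contra! h
  have hz0 : z ≠ 0 := norm_pos_iff.1 ((norm_nonneg _).trans_lt h)
  have h1 : ‖(π : K) / z‖ ≤ 1 := by
    rw [norm_div]; exact (div_le_one (norm_pos_iff.2 hz0)).2 h.le
  have hm : π = (⟨z, mem_RK.2 hz.le⟩ : RK K) * ⟨(π : K) / z, mem_RK.2 h1⟩ := by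
    ext; simp [mul_div_cancel₀ _ hz0]
  rcases hπ.isUnit_or_isUnit hm with hu | hu
  · exact hz.ne (isUnit_RK_iff.1 hu)
  · have := isUnit_RK_iff.1 hu
    simp only [norm_div] at this
    rw [div_eq_one_iff_eq (norm_pos_iff.2 hz0).ne'] at this
    exact h.ne this

theorem exists_norm_eq_pow (hπ : Irreducible π) {z : K} (hz : z ≠ 0) (hz1 : ‖z‖ ≤ 1) :
    ∃ j : ℕ, ‖z‖ = ‖(π : K)‖ ^ j := by
  obtain ⟨j, hj1, hj2⟩ := exists_nat_pow_near_of_lt_one (norm_pos_iff.2 hz) hz1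
    (norm_uniformizer_pos hπ) (norm_uniformizer_lt_one hπ)
  have hp := pow_pos (norm_uniformizer_pos hπ) j
  refine ⟨j, le_antisymm hj2 ?_⟩
  by_contra! h
  have h1 : ‖z / (π : K) ^ j‖ < 1 := by
    rw [norm_div, norm_pow]; exact (div_lt_one hp).2 h
  have h2 := norm_le_uniformizer hπ h1
  rw [norm_div, norm_pow, div_le_iff₀ hp, ← pow_succ'] at h2
  exact h2.not_gt hj1

theorem q_ne_zero (hπ : Irreducible π) (hnorm : ‖(π : K)‖ = (q K : ℝ)⁻¹) : q K ≠ 0 := by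
  intro h
  have := norm_uniformizer_pos hπ
  simp [hnorm, h] at this

theorem one_lt_q (hπ : Irreducible π) (hnorm : ‖(π : K)‖ = (q K : ℝ)⁻¹) : 1 < (q K : ℝ) := by
  have h0 : (0 : ℝ) < q K := by exact_mod_cast Nat.pos_of_ne_zero (q_ne_zero hπ hnorm)
  have h := norm_uniformizer_lt_one hπ
  rw [hnorm] at h
  exact (inv_lt_one₀ h0).1 h

/-- For the sup norm `(π ^ r R_K) ^ k` is a ball. Hence `δ_r` sees only the norm of its argument,
which is what lets `F(x)` be replaced by a linear coordinate later. -/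
theorem deltaApprox_eq (hπ : Irreducible π) {k : ℕ} (r : ℕ) (u : Fin k → K) :
    deltaApprox π r u =
      (Metric.closedBall (0 : Fin k → K) (‖(π : K)‖ ^ r)).indicator
        (fun _ => (q K : ℂ) ^ (r * k)) u := by
  have hp := pow_pos (norm_uniformizer_pos hπ) r
  have : (∀ i, ∃ a : RK K, u i = (π : K) ^ r * (a : K)) ↔
      u ∈ Metric.closedBall (0 : Fin k → K) (‖(π : K)‖ ^ r) := by
    rw [mem_closedBall_zero_iff, pi_norm_le_iff_of_nonneg hp.le]
    refine forall_congr' fun i => ⟨?_, fun h => ?_⟩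
    · rintro ⟨a, ha⟩
      rw [ha, norm_mul, norm_pow]
      exact mul_le_of_le_one_right hp.le (mem_RK.1 a.2)
    · refine ⟨⟨u i / (π : K) ^ r, mem_RK.2 ?_⟩, ?_⟩
      · rw [norm_div, norm_pow]; exact (div_le_one hp).2 h
      · simp [mul_div_cancel₀ _ (pow_ne_zero r (uniformizer_ne_zero hπ))]
  unfold deltaApprox
  by_cases h : u ∈ Metric.closedBall (0 : Fin k → K) (‖(π : K)‖ ^ r)
  · rw [if_pos (this.2 h), Set.indicator_of_mem h]
  · rw [if_neg (fun h' => h (this.1 h')), Set.indicator_of_notMem h]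

/-! ### Quasicharacters -/

theorem quasiVal_zero (ω : Kˣ →ₜ* ℂˣ) : quasiVal ω (0 : K) = 0 := by simp [quasiVal]

theorem quasiVal_units (ω : Kˣ →ₜ* ℂˣ) (u : Kˣ) : quasiVal ω (u : K) = ω u := by
  simp [quasiVal, u.ne_zero]

theorem quasiVal_mul (ω : Kˣ →ₜ* ℂˣ) (x y : K) :
    quasiVal ω (x * y) = quasiVal ω x * quasiVal ω y := by
  rcases eq_or_ne x 0 with rfl | hx
  · simp [quasiVal_zero]
  rcases eq_or_ne y 0 with rfl | hy
  · simp [quasiVal_zero]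
  have := quasiVal_units ω (Units.mk0 x hx * Units.mk0 y hy)
  rw [Units.val_mul, Units.val_mk0, Units.val_mk0] at this
  rw [this, map_mul, Units.val_mul, ← quasiVal_units, ← quasiVal_units, Units.val_mk0, Units.val_mk0]

theorem quasiVal_pow (ω : Kˣ →ₜ* ℂˣ) (x : K) (j : ℕ) :
    quasiVal ω (x ^ j) = quasiVal ω x ^ j := by
  induction j with
  | zero => simpa using quasiVal_units ω 1
  | succ j ih => rw [pow_succ, quasiVal_mul, ih, pow_succ]

theorem quasiVal_ne_zero (ω : Kˣ →ₜ* ℂˣ) {x : K} (hx : x ≠ 0) : quasiVal ω x ≠ 0 := by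
  simp [quasiVal, hx]

theorem continuousOn_quasiVal (ω : Kˣ →ₜ* ℂˣ) : ContinuousOn (quasiVal ω) {x : K | x ≠ 0} := by
  rw [continuousOn_iff_continuous_domRestrict]
  have : Set.domRestrict {x : K | x ≠ 0} (quasiVal ω) =
      fun x => ((ω (unitsHomeomorphNeZero.symm x) : ℂˣ) : ℂ) := by
    funext x
    rw [Set.domRestrict_apply, ← quasiVal_units]
    congr 1
    exact congrArg Subtype.val (unitsHomeomorphNeZero.apply_symm_apply x).symm
  rw [this]
  exact Units.continuous_val.comp (ω.continuous_toFun.comp unitsHomeomorphNeZero.symm.continuous)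

/-- The positivity of `σ(ω)` enters the proof through this inequality alone. -/
theorem norm_quasiVal_uniformizer_lt_one (hπ : Irreducible π)
    (hnorm : ‖(π : K)‖ = (q K : ℝ)⁻¹) {ω : Kˣ →ₜ* ℂˣ} (hω : ω ∈ Omega π 0) :
    ‖quasiVal ω (π : K)‖ < 1 := by
  have h : 0 < -Real.logb (q K) ‖quasiVal ω (π : K)‖ := hω
  have hp : 0 < ‖quasiVal ω (π : K)‖ :=
    norm_pos_iff.2 (quasiVal_ne_zero ω (uniformizer_ne_zero hπ))
  exact (Real.logb_neg_iff (one_lt_q hπ hnorm) hp).1 (by linarith)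

/-- Only continuity at `0` needs work. Write `z = π ^ j v` with `‖v‖ = 1`: `ω` is bounded on the
compact unit sphere, and `‖ω(π)‖ ^ j` tends to `0`. -/
theorem continuous_quasiVal [ProperSpace K] (hπ : Irreducible π)
    (hnorm : ‖(π : K)‖ = (q K : ℝ)⁻¹) {ω : Kˣ →ₜ* ℂˣ} (hω : ω ∈ Omega π 0) :
    Continuous (quasiVal ω : K → ℂ) := by
  rw [continuous_iff_continuousAt]
  intro x
  rcases ne_or_eq x 0 with hx | rfl
  · exact (continuousOn_quasiVal ω).continuousAt (isOpen_ne.mem_nhds hx)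
  obtain ⟨M, hM⟩ : ∃ M, ∀ z ∈ Metric.sphere (0 : K) 1, ‖quasiVal ω z‖ ≤ M :=
    (isCompact_sphere (0 : K) 1).exists_bound_of_continuousOn
      ((continuousOn_quasiVal ω).mono fun z hz h => by simp [h] at hz)
  have hM0 : 0 ≤ M := (norm_nonneg _).trans (hM 1 (by simp))
  have hlt := norm_quasiVal_uniformizer_lt_one hπ hnorm hω
  have hp := norm_uniformizer_pos hπ
  rw [Metric.continuousAt_iff]
  intro ε hε
  obtain ⟨N, hN⟩ : ∃ N : ℕ, ‖quasiVal ω (π : K)‖ ^ N * M < ε := by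
    have : Tendsto (fun N : ℕ => ‖quasiVal ω (π : K)‖ ^ N * M) atTop (𝓝 (0 * M)) :=
      (tendsto_pow_atTop_nhds_zero_of_lt_one (norm_nonneg _) hlt).mul_const M
    rw [zero_mul] at this
    exact (this.eventually (gt_mem_nhds hε)).exists
  refine ⟨‖(π : K)‖ ^ N, pow_pos hp N, fun {z} hz => ?_⟩
  rw [dist_zero_right] at hz
  rw [quasiVal_zero, dist_zero_right]
  rcases eq_or_ne z 0 with rfl | hz0
  · simpa [quasiVal_zero] using hε
  have hz1 : ‖z‖ ≤ 1 := hz.le.trans (pow_le_one₀ hp.le (norm_uniformizer_lt_one hπ).le)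
  obtain ⟨j, hj⟩ := exists_norm_eq_pow hπ hz0 hz1
  have hNj : N ≤ j := by
    by_contra! h
    have := pow_le_pow_of_le_one hp.le (norm_uniformizer_lt_one hπ).le h.le
    rw [hj] at hz
    exact this.not_gt hz
  have hπj : (π : K) ^ j ≠ 0 := pow_ne_zero j (uniformizer_ne_zero hπ)
  have hzz : z = (π : K) ^ j * (z / (π : K) ^ j) := (mul_div_cancel₀ z hπj).symm
  rw [hzz, quasiVal_mul, quasiVal_pow, norm_mul, norm_pow]
  have hs : z / (π : K) ^ j ∈ Metric.sphere (0 : K) 1 := by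
    simp [hj, hp.ne']
  calc _ ≤ ‖quasiVal ω (π : K)‖ ^ N * M := by
        gcongr ?_ * ?_
        · exact pow_le_pow_of_le_one (norm_nonneg _) hlt.le hNj
        · exact hM _ hs
    _ < ε := hN

/-! ### Haar measure of balls and multiplication -/

variable [MeasurableSpace K] [BorelSpace K] {ν : Measure K} [ν.IsAddHaarMeasure]

open scoped Pointwise in
-- `R_K` is the disjoint union of `q` translates of its maximal ideal, one for each residue class.
theorem measure_closedBall_norm_uniformizer (hπ : Irreducible π)
    (hnorm : ‖(π : K)‖ = (q K : ℝ)⁻¹) (hν : ν (RK K : Set K) = 1) :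
    ν (Metric.closedBall 0 ‖(π : K)‖) = (q K : ℝ≥0∞)⁻¹ := by
  have hq := q_ne_zero hπ hnorm
  -- `Nat.card` is `0` on an infinite type, so `q ≠ 0`, a consequence of the normalization, yields
  -- finiteness.
  have : Finite (IsLocalRing.ResidueField (RK K)) := Nat.finite_of_card_ne_zero hq
  set B := Metric.closedBall (0 : K) ‖(π : K)‖ with hB
  have hp := norm_uniformizer_pos hπ
  choose t ht using IsLocalRing.residue_surjective (R := RK K)
  have hres : ∀ a b : RK K, IsLocalRing.residue (RK K) a = IsLocalRing.residue (RK K) b ↔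
      ‖(a : K) - b‖ ≤ ‖(π : K)‖ := by
    intro a b
    rw [← sub_eq_zero, ← map_sub, IsLocalRing.residue_eq_zero_iff, IsLocalRing.mem_maximalIdeal,
      mem_nonunits_iff, isUnit_RK_iff]
    have h1 : ‖((a - b : RK K) : K)‖ ≤ 1 := mem_RK.1 (a - b).2
    rw [show (a : K) - b = ((a - b : RK K) : K) by simp]
    constructor
    · intro h; exact norm_le_uniformizer hπ (lt_of_le_of_ne h1 h)
    · intro h; exact (h.trans_lt (norm_uniformizer_lt_one hπ)).ne
  have hU : (RK K : Set K) = ⋃ c, ((t c : K) +ᵥ B) := by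
    ext z
    simp only [Set.mem_iUnion, Set.mem_vadd_set_iff_neg_vadd_mem, vadd_eq_add, hB,
      mem_closedBall_zero_iff]
    constructor
    · intro hz
      refine ⟨IsLocalRing.residue (RK K) ⟨z, hz⟩, ?_⟩
      rw [neg_add_eq_sub, ← hres ⟨z, hz⟩, ht]
    · rintro ⟨c, hc⟩
      have : z = t c + (-(t c : K) + z) := by ring
      rw [this]
      exact (RK K).add_mem _ _ (t c).2 (mem_RK.2 (hc.trans (mem_RK.1 π.2)))
  have hd : Pairwise (Function.onFun Disjoint fun c => ((t c : K) +ᵥ B)) := by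
    intro c d hcd
    rw [Function.onFun, Set.disjoint_left]
    intro z hz hz'
    simp only [Set.mem_vadd_set_iff_neg_vadd_mem, vadd_eq_add, hB,
      mem_closedBall_zero_iff, neg_add_eq_sub] at hz hz'
    refine hcd ?_
    rw [← ht c, ← ht d, hres]
    have : (t c : K) - t d = (z - t d) - (z - t c) := by ring
    rw [this]
    rw [sub_eq_add_neg]
    exact (IsUltrametricDist.norm_add_le_max _ _).trans (max_le hz' (by rwa [norm_neg]))
  have hm : MeasurableSet B := measurableSet_closedBall
  rw [hU, measure_iUnion hd (fun c => hm.const_vadd _)] at hν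
  simp only [measure_vadd] at hν
  rw [ENNReal.tsum_const, ENat.card_eq_coe_natCard] at hν
  have hν' : (q K : ℝ≥0∞) * ν B = 1 := by simpa [q] using hν
  rw [mul_comm] at hν'
  exact ENNReal.eq_inv_of_mul_eq_one_left hν'

open scoped Pointwise in
-- The Haar modulus and the norm are both multiplicative. They agree on elements of norm `1`, which
-- preserve `R_K`, and on `π`; these generate `Kˣ`.
theorem measure_smul_units [ProperSpace K] (hπ : Irreducible π)
    (hnorm : ‖(π : K)‖ = (q K : ℝ)⁻¹) (hν : ν (RK K : Set K) = 1) (a : Kˣ) (s : Set K) :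
    ν (a • s) = ‖(a : K)‖ₑ * ν s := by
  have hR0 : ν (RK K : Set K) ≠ 0 := by simp [hν]
  have hR1 : ν (RK K : Set K) ≠ ∞ := by simp [hν]
  have hmul : ∀ (b : Kˣ), (b • (RK K : Set K)) = Metric.closedBall 0 ‖(b : K)‖ := by
    intro b
    ext z
    rw [Set.mem_smul_set_iff_inv_smul_mem, coe_RK, mem_closedBall_zero_iff,
      mem_closedBall_zero_iff, Units.smul_def, smul_eq_mul, norm_mul]
    simp [inv_mul_le_one₀ (norm_pos_iff.2 b.ne_zero)]
  have hunit : ∀ b : Kˣ, ‖(b : K)‖ = 1 → distribHaarChar K b = ‖(b : K)‖₊ := by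
    intro b hb
    refine distribHaarChar_eq_of_measure_smul_eq_mul hR0 hR1 ?_
    rw [hmul, hb, ← coe_RK, show ‖(b : K)‖₊ = 1 from Subtype.ext hb]; simp
  set p := Units.mk0 (π : K) (uniformizer_ne_zero hπ) with hp
  have hpi : distribHaarChar K p = ‖(p : K)‖₊ := by
    refine distribHaarChar_eq_of_measure_smul_eq_mul hR0 hR1 ?_
    rw [hmul, hν, mul_one, hp, Units.val_mk0, measure_closedBall_norm_uniformizer hπ hnorm hν]
    rw [← enorm_eq_nnnorm, ← ofReal_norm, hnorm, ENNReal.ofReal_inv_of_pos]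
    · simp
    · linarith [one_lt_q hπ hnorm]
  have hle : ∀ b : Kˣ, ‖(b : K)‖ ≤ 1 → distribHaarChar K b = ‖(b : K)‖₊ := by
    intro b hb
    obtain ⟨j, hj⟩ := exists_norm_eq_pow hπ b.ne_zero hb
    have hb' : b = p ^ j * (b / p ^ j) := by rw [mul_div_cancel]
    have hu : ‖((b / p ^ j : Kˣ) : K)‖ = 1 := by
      simp [hj, hp, div_self (pow_ne_zero j (norm_uniformizer_pos hπ).ne')]
    rw [hb', map_mul, map_pow, hpi, hunit _ hu]
    simp only [Units.val_mul, Units.val_pow_eq_pow_val, nnnorm_mul, nnnorm_pow]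
  have hall : distribHaarChar K a = ‖(a : K)‖₊ := by
    rcases le_total ‖(a : K)‖ 1 with h | h
    · exact hle a h
    · have := hle a⁻¹ (by simpa using inv_le_one_of_one_le₀ h)
      simpa using this
  rw [← distribHaarChar_mul, hall, enorm_eq_nnnorm]

open scoped Pointwise in
theorem measure_closedBall_pow [ProperSpace K] (hπ : Irreducible π)
    (hnorm : ‖(π : K)‖ = (q K : ℝ)⁻¹) (hν : ν (RK K : Set K) = 1) (r : ℕ) :
    ν (Metric.closedBall 0 (‖(π : K)‖ ^ r)) = ((q K : ℝ≥0∞) ^ r)⁻¹ := by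
  have h := measure_smul_units hπ hnorm hν
    (Units.mk0 ((π : K) ^ r) (pow_ne_zero r (uniformizer_ne_zero hπ))) (RK K : Set K)
  have hs : (Metric.closedBall (0 : K) (‖(π : K)‖ ^ r)) =
      Units.mk0 ((π : K) ^ r) (pow_ne_zero r (uniformizer_ne_zero hπ)) • (RK K : Set K) := by
    ext z
    rw [Set.mem_smul_set_iff_inv_smul_mem, coe_RK, mem_closedBall_zero_iff,
      mem_closedBall_zero_iff, Units.smul_def, smul_eq_mul, norm_mul]
    simp [inv_mul_le_one₀ (pow_pos (norm_uniformizer_pos hπ) r)]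
  rw [hs, h, hν, mul_one, Units.val_mk0, ← ofReal_norm, norm_pow, hnorm, inv_pow,
    ENNReal.ofReal_inv_of_pos]
  · rw [ENNReal.ofReal_pow (by positivity)]; simp
  · have := one_lt_q hπ hnorm
    positivity

theorem measure_pi_closedBall_pow [ProperSpace K] (hπ : Irreducible π)
    (hnorm : ‖(π : K)‖ = (q K : ℝ)⁻¹) (hν : ν (RK K : Set K) = 1) (k r : ℕ) :
    Measure.pi (fun _ : Fin k => ν) (Metric.closedBall 0 (‖(π : K)‖ ^ r)) =
      ((q K : ℝ≥0∞) ^ (r * k))⁻¹ := by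
  rw [closedBall_pi _ (pow_pos (norm_uniformizer_pos hπ) r).le, Measure.pi_pi]
  simp only [Pi.zero_apply, measure_closedBall_pow hπ hnorm hν, Finset.prod_const,
    Finset.card_univ, Fintype.card_fin]
  rw [pow_mul, ENNReal.inv_pow, ENNReal.inv_pow, ENNReal.inv_pow]

open scoped Pointwise in
theorem smul_map_mul_left [ProperSpace K] (hπ : Irreducible π)
    (hnorm : ‖(π : K)‖ = (q K : ℝ)⁻¹) (hν : ν (RK K : Set K) = 1) {a : K} (ha : a ≠ 0)
    (s : Set K) : ‖a‖ₑ * ν ((a * ·) ⁻¹' s) = ν s := by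
  have h := measure_smul_units hπ hnorm hν (Units.mk0 a ha) ((a * ·) ⁻¹' s)
  rw [Units.val_mk0] at h
  rw [← h]
  congr 1
  ext z
  rw [Set.mem_smul_set_iff_inv_smul_mem, Set.mem_preimage, Units.smul_def, smul_eq_mul]
  simp [mul_inv_cancel_left₀ ha]

end FieldLemmas

/-! ### Linear maps scale Haar measure by the norm of the determinant. -/

section LinearHaar

variable {K : Type*} [NontriviallyNormedField K] [IsUltrametricDist K] [ProperSpace K]
  {π : RK K} [MeasurableSpace K] [BorelSpace K] {ν : Measure K} [ν.IsAddHaarMeasure]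
  {ι : Type*} [Fintype ι] [DecidableEq ι]

open Matrix

theorem smul_map_diagonal_pi (hπ : Irreducible π) (hnorm : ‖(π : K)‖ = (q K : ℝ)⁻¹)
    (hν : ν (RK K : Set K) = 1) {D : ι → K} (h : det (diagonal D) ≠ 0) :
    ‖det (diagonal D)‖ₑ • Measure.map (toLin' (diagonal D)) (Measure.pi fun _ : ι => ν) =
      Measure.pi fun _ => ν := by
  refine (Measure.pi_eq fun s hs => ?_).symm
  simp only [det_diagonal, Measure.coe_smul, smul_eq_mul, Pi.smul_apply] at h ⊢
  rw [Measure.map_apply (Continuous.measurable (LinearMap.continuous_on_pi _))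
    (MeasurableSet.univ_pi hs)]
  have : (Matrix.toLin' (diagonal D) ⁻¹' Set.pi Set.univ fun i : ι => s i) =
      Set.pi Set.univ fun i : ι => (D i * ·) ⁻¹' s i := by
    ext f
    simp only [LinearMap.coe_proj, smul_eq_mul, LinearMap.smul_apply, Set.mem_univ_pi,
      Set.mem_preimage, LinearMap.pi_apply, diagonal_toLin']
  have hprod : ‖∏ i, D i‖ₑ = ∏ i, ‖D i‖ₑ := by
    simp only [enorm_eq_nnnorm, nnnorm_prod]
    push_cast
    rfl
  rw [this, Measure.pi_pi, hprod, ← Finset.prod_mul_distrib]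
  exact Finset.prod_congr rfl fun i _ =>
    smul_map_mul_left hπ hnorm hν (Finset.prod_ne_zero_iff.1 h i (Finset.mem_univ i)) _

theorem measurePreserving_transvection (t : TransvectionStruct ι K) :
    MeasurePreserving (toLin' t.toMatrix) (Measure.pi fun _ : ι => ν)
      (Measure.pi fun _ : ι => ν) := by
  have ht : Measurable (toLin' t.toMatrix) :=
    Continuous.measurable (LinearMap.continuous_on_pi _)
  refine ⟨ht, ?_⟩
  refine (Measure.pi_eq fun s hs ↦ ?_).symm
  have h2s : MeasurableSet (Set.univ.pi s) := .pi Set.countable_univ fun i _ ↦ hs i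
  simp_rw [← Measure.pi_pi, ← lintegral_indicator_one h2s]
  rw [lintegral_map (measurable_one.indicator h2s) ht]
  refine lintegral_eq_of_lmarginal_eq {t.i} ((measurable_one.indicator h2s).comp ht)
    (measurable_one.indicator h2s) ?_
  simp_rw [lmarginal_singleton]
  ext x
  cases t with | mk t_i t_j t_hij t_c =>
  simp [transvection, single_mulVec, t_hij.symm, ← Function.update_add,
    lintegral_add_right_eq_self fun xᵢ ↦ Set.indicator (Set.univ.pi s) 1 (Function.update x t_i xᵢ)]

/-- As over the reals: an invertible matrix is a product of diagonal matrices and transvections, and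
the latter preserve the measure by Fubini and translation invariance. -/
theorem smul_map_matrix_pi (hπ : Irreducible π) (hnorm : ‖(π : K)‖ = (q K : ℝ)⁻¹)
    (hν : ν (RK K : Set K) = 1) {M : Matrix ι ι K} (hM : det M ≠ 0) :
    ‖det M‖ₑ • Measure.map (toLin' M) (Measure.pi fun _ : ι => ν) =
      Measure.pi fun _ => ν := by
  apply diagonal_transvection_induction_of_det_ne_zero _ M hM
  · intro D hD
    exact smul_map_diagonal_pi hπ hnorm hν hD
  · intro t
    simp [TransvectionStruct.det, (measurePreserving_transvection (ν := ν) t).map_eq]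
  · intro A B _ _ IHA IHB
    have hm : ∀ C : Matrix ι ι K, Measurable (toLin' C) := fun C =>
      Continuous.measurable (LinearMap.continuous_on_pi _)
    rw [toLin'_mul, det_mul, LinearMap.coe_comp, ← Measure.map_map (hm A) (hm B), enorm_mul,
      mul_smul, ← Measure.map_smul, IHB, IHA]

end LinearHaar

/-! ### Ultrametric isometries and maps close to the identity. -/

section Isometry

theorem norm_eq_of_norm_sub_lt {E : Type*} [NormedAddCommGroup E] [IsUltrametricDist E] {a b : E}
    (h : ‖a - b‖ < ‖b‖) : ‖a‖ = ‖b‖ := by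
  have := IsUltrametricDist.norm_eq_of_add_norm_lt_max (x := a) (y := -b)
    (by rw [← sub_eq_add_neg, norm_neg]; exact lt_max_of_lt_right h)
  rwa [norm_neg] at this

variable {X Z : Type*} [NormedAddCommGroup X] [NormedAddCommGroup Z] [IsUltrametricDist X]

theorem isTopologicalBasis_closedBall :
    TopologicalSpace.IsTopologicalBasis
      {s : Set X | ∃ (x : X) (r : ℝ), 0 < r ∧ s = Metric.closedBall x r} := by
  refine TopologicalSpace.isTopologicalBasis_of_isOpen_of_nhds ?_ ?_
  · rintro s ⟨x, r, hr, rfl⟩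
    exact IsUltrametricDist.isOpen_closedBall x hr.ne'
  · intro x u hx hu
    obtain ⟨r, hr, h⟩ := Metric.nhds_basis_closedBall.mem_iff.1 (hu.mem_nhds hx)
    exact ⟨_, ⟨x, r, hr, rfl⟩, Metric.mem_closedBall_self hr.le, h⟩

theorem isPiSystem_closedBall :
    IsPiSystem {s : Set X | ∃ (x : X) (r : ℝ), 0 < r ∧ s = Metric.closedBall x r} := by
  rintro _ ⟨x, r, hr, rfl⟩ _ ⟨y, s, hs, rfl⟩ hne
  rcases IsUltrametricDist.closedBall_subset_trichotomy (x := x) (r := r) (y := y) (s := s) with h | h | h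
  · exact ⟨x, r, hr, Set.inter_eq_left.2 h⟩
  · exact ⟨y, s, hs, Set.inter_eq_right.2 h⟩
  · exact absurd hne (Set.not_nonempty_iff_eq_empty.2 h.inter_eq)

variable [MeasurableSpace X] [BorelSpace X] [SecondCountableTopology X]

/-- A map which is an isometry of a closed ball onto the closed ball of the same radius preserves
the Haar measure. -/
theorem map_restrict_closedBall_eq {μ : Measure X} [μ.IsAddHaarMeasure] [ProperSpace X]
    {H : X → X} {z : X} {ρ : ℝ} (hρ : 0 < ρ)
    (hiso : ∀ x ∈ Metric.closedBall z ρ, ∀ y ∈ Metric.closedBall z ρ, ‖H x - H y‖ = ‖x - y‖)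
    (hsurj : Set.SurjOn H (Metric.closedBall z ρ) (Metric.closedBall (H z) ρ)) :
    Measure.map H (μ.restrict (Metric.closedBall z ρ)) =
      μ.restrict (Metric.closedBall (H z) ρ) := by
  set B := Metric.closedBall z ρ
  set B' := Metric.closedBall (H z) ρ
  have hzB : z ∈ B := Metric.mem_closedBall_self hρ.le
  have hcont : ContinuousOn H B := by
    refine LipschitzOnWith.continuousOn (K := 1) ?_
    refine LipschitzOnWith.of_dist_le_mul fun x hx y hy => ?_
    simp [dist_eq_norm, hiso x hx y hy]
  have hmaps : Set.MapsTo H B B' := fun x hx => by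
    have := hiso x hx z hzB
    rw [Metric.mem_closedBall, dist_eq_norm, this, ← dist_eq_norm]; exact hx
  have hBm : MeasurableSet B := measurableSet_closedBall
  have hae : AEMeasurable H (μ.restrict B) := hcont.aemeasurable hBm
  have hBB' : μ B = μ B' := by
    simp only [B, B']
    rw [Measure.addHaar_closedBall_center μ z, Measure.addHaar_closedBall_center μ (H z)]
  have hfin : μ B < ∞ := (isCompact_closedBall z ρ).measure_lt_top
  have : IsFiniteMeasure (μ.restrict B) := ⟨by simpa using hfin⟩
  refine ext_of_generate_finite _
    (BorelSpace.measurable_eq.trans isTopologicalBasis_closedBall.borel_eq_generateFrom)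
    isPiSystem_closedBall ?_ ?_
  · rintro _ ⟨w, ε, hε, rfl⟩
    have hDm : MeasurableSet (Metric.closedBall w ε) := measurableSet_closedBall
    rw [Measure.map_apply_of_aemeasurable hae hDm, Measure.restrict_apply hDm,
      Measure.restrict_apply' hBm]
    by_cases hne : (Metric.closedBall w ε ∩ B').Nonempty
    swap
    · rw [Set.not_nonempty_iff_eq_empty] at hne
      have : H ⁻¹' Metric.closedBall w ε ∩ B = ∅ := by
        rw [Set.eq_empty_iff_forall_notMem] at hne ⊢
        exact fun x hx => hne (H x) ⟨hx.1, hmaps hx.2⟩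
      rw [hne, this]
    obtain ⟨v, hv, hvB⟩ := hne
    obtain ⟨x, hx, rfl⟩ := hsurj hvB
    -- Every point of an ultrametric ball is a centre, so all balls can be centred at `H x` or at
    -- `x`. The two sets then become balls of radius `min ε ρ`, which have equal Haar measure.
    rw [IsUltrametricDist.closedBall_eq_of_mem hv]
    have hB : B = Metric.closedBall x ρ := IsUltrametricDist.closedBall_eq_of_mem hx
    have hB' : B' = Metric.closedBall (H x) ρ := IsUltrametricDist.closedBall_eq_of_mem hvB
    have h1 : H ⁻¹' Metric.closedBall (H x) ε ∩ B = Metric.closedBall x (min ε ρ) := by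
      ext y
      rw [Metric.mem_closedBall, le_min_iff, ← Metric.mem_closedBall, ← Metric.mem_closedBall, ← hB]
      simp only [Set.mem_inter_iff, and_congr_left_iff]
      intro hy
      rw [Set.mem_preimage, Metric.mem_closedBall, Metric.mem_closedBall, dist_eq_norm,
        dist_eq_norm, hiso y hy x hx]
    have h2 : Metric.closedBall (H x) ε ∩ B' = Metric.closedBall (H x) (min ε ρ) := by
      ext y
      rw [hB', Set.mem_inter_iff]
      simp only [Metric.mem_closedBall, le_min_iff]
    rw [h1, h2, Measure.addHaar_closedBall_center μ x, Measure.addHaar_closedBall_center μ (H x)]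
  · rw [Measure.map_apply_of_aemeasurable hae MeasurableSet.univ]
    simp [hBB']

/-- A map that is strictly close to the identity on a closed ball maps it isometrically onto the
closed ball of the same radius. -/
theorem isometry_of_approx_id [CompleteSpace X] {H : X → X} {z : X} {ρ : ℝ}
    (happ : ∀ x ∈ Metric.closedBall z ρ, ∀ y ∈ Metric.closedBall z ρ,
      ‖H x - H y - (x - y)‖ ≤ 1 / 2 * ‖x - y‖) :
    (∀ x ∈ Metric.closedBall z ρ, ∀ y ∈ Metric.closedBall z ρ, ‖H x - H y‖ = ‖x - y‖) ∧
    Set.SurjOn H (Metric.closedBall z ρ) (Metric.closedBall (H z) ρ) := by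
  have hiso : ∀ x ∈ Metric.closedBall z ρ, ∀ y ∈ Metric.closedBall z ρ,
      ‖H x - H y‖ = ‖x - y‖ := by
    intro x hx y hy
    rcases eq_or_ne x y with rfl | hxy
    · simp
    have h0 : 0 < ‖x - y‖ := norm_pos_iff.2 (sub_ne_zero.2 hxy)
    have h1 := happ x hx y hy
    exact norm_eq_of_norm_sub_lt (by linarith)
  refine ⟨hiso, fun w hw => ?_⟩
  have hρ : 0 ≤ ρ := dist_nonneg.trans hw
  have hz : z ∈ Metric.closedBall z ρ := Metric.mem_closedBall_self hρ
  -- A fixed point of `T` is a solution of `H x = w`.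
  set T : X → X := fun x => x - H x + w with hT
  have hdist : ∀ x ∈ Metric.closedBall z ρ, ∀ y ∈ Metric.closedBall z ρ,
      dist (T x) (T y) ≤ 1 / 2 * dist x y := by
    intro x hx y hy
    rw [dist_eq_norm, dist_eq_norm, hT]
    have : x - H x + w - (y - H y + w) = - (H x - H y - (x - y)) := by abel
    simp only [this, norm_neg]
    exact happ x hx y hy
  have hmaps : Set.MapsTo T (Metric.closedBall z ρ) (Metric.closedBall z ρ) := by
    intro x hx
    have h1 : dist (T x) (T z) ≤ ρ := by
      have := hdist x hx z hz
      rw [Metric.mem_closedBall] at hx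
      linarith [dist_nonneg (x := x) (y := z)]
    have h2 : dist (T z) z ≤ ρ := by
      rw [Metric.mem_closedBall, dist_eq_norm] at hw
      rw [dist_eq_norm, hT]
      have : z - H z + w - z = w - H z := by abel
      simpa [this] using hw
    -- The strong triangle inequality keeps `T` inside the ball without any loss of radius.
    exact (dist_triangle_max _ _ _).trans (max_le h1 h2)
  have hc : ContractingWith (1 / 2) (hmaps.restrict T _ _) := by
    refine ⟨by norm_num, LipschitzWith.of_dist_le_mul fun x y => ?_⟩
    exact (hdist x x.2 y y.2).trans_eq (by simp [Subtype.dist_eq])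
  obtain ⟨x, hx, hfix, -⟩ := hc.exists_fixedPoint' Metric.isClosed_closedBall.isComplete hmaps hz
    (edist_ne_top _ _)
  refine ⟨x, hx, ?_⟩
  have : x - H x + w = x := hfix
  have h3 : w - H x = 0 := by
    have h4 := sub_eq_zero.2 this
    rw [← h4]; abel
  exact (sub_eq_zero.1 h3).symm

end Isometry

/-! ### Power series converging on an open set are analytic there. -/

section Analytic

variable {K : Type*} [NontriviallyNormedField K] {n : ℕ}

/-- Writing the monomial as a word in the variables makes it the diagonal of a multilinear map in
`β.degree` arguments. -/
theorem exists_word (β : Fin n →₀ ℕ) : ∃ j : Fin β.degree → Fin n,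
    ∀ x : Fin n → K, ∏ t, x (j t) = ∏ i, x i ^ β i := by
  obtain ⟨l, hl⟩ : ∃ l : List (Fin n), (l : Multiset (Fin n)) = Finsupp.toMultiset β :=
    Quot.exists_rep _
  have hlen : l.length = β.degree := by
    rw [← Multiset.coe_card, hl, Finsupp.card_toMultiset, Finsupp.degree_eq_sum,
      Finsupp.sum_fintype _ _ (fun _ => rfl)]
    rfl
  rw [← hlen]
  refine ⟨fun t => l[t], fun x => ?_⟩
  have hprod : ∏ t : Fin l.length, x l[t] = (l.map x).prod := Fin.prod_univ_fun_getElem l x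
  rw [hprod, ← Multiset.prod_coe, ← Multiset.map_coe, hl,
    Finset.prod_multiset_map_count]
  simp only [Finsupp.count_toMultiset]
  refine Finset.prod_subset (Finset.subset_univ _) fun i _ hi => ?_
  rw [Finsupp.toFinset_toMultiset, Finsupp.notMem_support_iff] at hi
  simp [hi]

/-- Keeping `d` independent of `β.degree` (with the zero map when they differ) lets maps for
different `β` be added in one type. -/
theorem exists_multilinear_monomial (d : ℕ) (β : Fin n →₀ ℕ) :
    ∃ M : ContinuousMultilinearMap K (fun _ : Fin d => Fin n → K) K,
      (∀ v, ‖M v‖ ≤ ∏ t, ‖v t‖) ∧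
      (β.degree = d → ∀ x : Fin n → K, M (fun _ => x) = ∏ i, x i ^ β i) := by
  by_cases h : β.degree = d
  · subst h
    obtain ⟨j, hj⟩ := exists_word (K := K) β
    refine ⟨(ContinuousMultilinearMap.mkPiAlgebra K (Fin β.degree) K).compContinuousLinearMap
      fun t => ContinuousLinearMap.proj (j t), fun v => ?_, fun _ x => ?_⟩
    · simp only [ContinuousMultilinearMap.compContinuousLinearMap_apply,
        ContinuousMultilinearMap.mkPiAlgebra_apply, ContinuousLinearMap.proj_apply, norm_prod]
      exact Finset.prod_le_prod (fun _ _ => norm_nonneg _) fun t _ => norm_le_pi_norm _ _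
    · simpa using hj x
  · refine ⟨0, fun v => ?_, fun h' => absurd h' h⟩
    simpa using Finset.prod_nonneg fun t _ => norm_nonneg (v t)

variable [IsUltrametricDist K]

/-- Group the monomials by degree. By the ultrametric inequality each homogeneous part still has
norm at most `C`, so the radius of convergence is at least `1`. -/
theorem analyticAt_of_hasSum_monomial [CompleteSpace K] {F : (Fin n → K) → K} {z : Fin n → K}
    {b : (Fin n →₀ ℕ) → K} {C : ℝ} (hb : ∀ β, ‖b β‖ ≤ C)
    (hF : ∀ h : Fin n → K, ‖h‖ < 1 → HasSum (fun β => b β * ∏ i, h i ^ β i) (F (z + h))) :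
    AnalyticAt K F z := by
  have hC : 0 ≤ C := (norm_nonneg _).trans (hb 0)
  choose M hM1 hM2 using fun d β => exists_multilinear_monomial (K := K) (n := n) d β
  let p : FormalMultilinearSeries K (Fin n → K) K := fun d =>
    ∑ β ∈ Finset.finsuppAntidiag Finset.univ d, b β • M d β
  have hset : ∀ d, (Finsupp.degree : (Fin n →₀ ℕ) → ℕ) ⁻¹' {d} =
      ↑(Finset.finsuppAntidiag (Finset.univ : Finset (Fin n)) d) := by
    intro d
    ext β
    simp [Finset.mem_finsuppAntidiag, Finsupp.degree_eq_sum]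
  refine ⟨p, 1, ?_, one_pos, ?_⟩
  · refine (p.le_radius_of_bound (r := 1) C fun d => ?_)
    simp only [NNReal.coe_one, one_pow, mul_one]
    refine ContinuousMultilinearMap.opNorm_le_bound hC fun v => ?_
    simp only [p, _root_.sum_apply, _root_.smul_apply,
      smul_eq_mul]
    refine IsUltrametricDist.norm_sum_le_of_forall_le_of_nonneg
      (mul_nonneg hC (Finset.prod_nonneg fun t _ => norm_nonneg (v t))) fun β _ => ?_
    rw [norm_mul]
    exact mul_le_mul (hb β) (hM1 d β v) (norm_nonneg _) hC
  · intro y hy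
    have hy1 : ‖y‖ < 1 := by simpa [← ofReal_norm] using hy
    have h := (hF y hy1).tsum_fiberwise Finsupp.degree
    refine h.congr_fun ?_
    intro d
    rw [hset, Finset.tsum_subtype' _ (fun β => b β * ∏ i, y i ^ β i)]
    simp only [p, _root_.sum_apply, _root_.smul_apply,
      smul_eq_mul]
    refine Finset.sum_congr rfl fun β hβ => ?_
    have hβ' : β ∈ (Finsupp.degree : (Fin n →₀ ℕ) → ℕ) ⁻¹' {d} := by rw [hset]; exact hβ
    rw [hM2 d β hβ']

theorem norm_prod_pow_le_one {h : Fin n → K} (hh : ‖h‖ ≤ 1) (β : Fin n →₀ ℕ) :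
    ‖∏ i, h i ^ β i‖ ≤ 1 := by
  rw [norm_prod]
  refine Finset.prod_le_one (fun _ _ => norm_nonneg _) fun i _ => ?_
  rw [norm_pow]
  exact pow_le_one₀ (norm_nonneg _) ((norm_le_pi_norm h i).trans hh)

/-- Taylor expansion at a point with natural coordinates of a power series whose coefficients
tend to zero. -/
theorem analyticAt_tsum_of_tendsto [CompleteSpace K] {a : (Fin n →₀ ℕ) → K}
    (ha : Tendsto a cofinite (𝓝 0)) (z : Fin n → ℕ) :
    AnalyticAt K (fun y : Fin n → K => ∑' α, a α * ∏ i, y i ^ α i) (fun i => (z i : K)) := by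
  classical
  -- Expanding `∏ (z_i + X_i) ^ α_i` over `ℕ` gives coefficients that are natural numbers, hence of
  -- norm at most `1` in `K`.
  let P : (Fin n →₀ ℕ) → MvPolynomial (Fin n) ℕ := fun α =>
    ∏ i, (MvPolynomial.C (z i) + MvPolynomial.X i) ^ α i
  let c : (Fin n →₀ ℕ) → (Fin n →₀ ℕ) → K := fun α β => ((MvPolynomial.coeff β (P α) : ℕ) : K)
  have hc : ∀ α β, ‖c α β‖ ≤ 1 := fun α β => IsUltrametricDist.norm_natCast_le_one K _
  have hP : ∀ (α : Fin n →₀ ℕ) (h : Fin n → K),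
      ∑ β ∈ (P α).support, c α β * ∏ i, h i ^ β i = ∏ i, ((z i : K) + h i) ^ α i := by
    intro α h
    refine (MvPolynomial.eval₂_eq' (Nat.castRingHom K) h (P α)).symm.trans ?_
    rw [← MvPolynomial.coe_eval₂Hom]
    simp only [P, map_prod, map_pow, map_add, MvPolynomial.coe_eval₂Hom, MvPolynomial.eval₂_C,
      MvPolynomial.eval₂_X, Nat.coe_castRingHom]
  obtain ⟨C, hC⟩ : ∃ C, ∀ α, ‖a α‖ ≤ C := by
    obtain ⟨C, hC⟩ := ha.norm.bddAbove_range_of_cofinite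
    exact ⟨C, fun α => hC ⟨α, rfl⟩⟩
  have hC0 : 0 ≤ C := (norm_nonneg _).trans (hC 0)
  have hsumβ : ∀ β, Summable fun α => a α * c α β := by
    intro β
    refine NonarchimedeanAddGroup.summable_of_tendsto_cofinite_zero ?_
    refine squeeze_zero_norm (fun α => ?_) (tendsto_zero_iff_norm_tendsto_zero.1 ha)
    rw [norm_mul]
    exact mul_le_of_le_one_right (norm_nonneg _) (hc α β)
  refine analyticAt_of_hasSum_monomial (b := fun β => ∑' α, a α * c α β) (C := C) (fun β => ?_) ?_
  · refine IsUltrametricDist.norm_tsum_le_of_forall_le_of_nonneg hC0 fun α => ?_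
    rw [norm_mul]
    exact (mul_le_of_le_one_right (norm_nonneg _) (hc α β)).trans (hC α)
  · intro h hh
    let G : (Fin n →₀ ℕ) × (Fin n →₀ ℕ) → K := fun x => a x.1 * c x.1 x.2 * ∏ i, h i ^ x.2 i
    -- Only finitely many `α` have a large `a α`, and each contributes finitely many `β`. Terms
    -- tending to zero suffice for summability here, so the double sum may be taken in either order.
    have hG0 : Tendsto G cofinite (𝓝 0) := by
      rw [Metric.tendsto_nhds]
      intro ε hε
      have hfin : {α | ¬ ‖a α‖ < ε}.Finite := by
        have := Metric.tendsto_nhds.1 ha ε hε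
        simpa [Filter.eventually_cofinite] using this
      rw [Filter.eventually_cofinite]
      refine (hfin.biUnion (t := fun α => (Prod.mk α) '' ((P α).support : Set (Fin n →₀ ℕ)))
        fun α _ => ((P α).support.finite_toSet.image _)).subset ?_
      rintro ⟨α, β⟩ hx
      simp only [Set.mem_ofPred_eq, dist_zero_right, G] at hx
      simp only [Set.mem_iUnion, Set.mem_image]
      refine ⟨α, fun hlt => hx (lt_of_le_of_lt ?_ hlt), β, ?_, rfl⟩
      · rw [norm_mul, norm_mul, mul_assoc]
        exact mul_le_of_le_one_right (norm_nonneg _)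
          (mul_le_one₀ (hc α β) (norm_nonneg _) (norm_prod_pow_le_one hh.le β))
      · by_contra hβ
        refine hx ?_
        have : c α β = 0 := by simp [c, MvPolynomial.notMem_support_iff.1 hβ]
        simpa [this] using hε
    have hG : Summable G := NonarchimedeanAddGroup.summable_of_tendsto_cofinite_zero hG0
    obtain ⟨S, hS⟩ := hG
    have h1 : HasSum (fun α => a α * ∏ i, ((z i : K) + h i) ^ α i) S := by
      refine hS.prod_fiberwise fun α => ?_
      rw [← hP α h, Finset.mul_sum]
      have : HasSum (fun β => G (α, β)) (∑ β ∈ (P α).support, G (α, β)) :=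
        hasSum_sum_of_ne_finset_zero
          fun β hβ => by simp [G, c, MvPolynomial.notMem_support_iff.1 hβ]
      simpa only [G, mul_assoc] using this
    have h2 : HasSum (fun β => (∑' α, a α * c α β) * ∏ i, h i ^ β i) S := by
      have hS' := (Equiv.prodComm (Fin n →₀ ℕ) (Fin n →₀ ℕ)).hasSum_iff.2 hS
      refine hS'.prod_fiberwise fun β => ?_
      exact (hsumβ β).hasSum.mul_right _
    simpa only [Pi.add_apply, h1.tsum_eq] using h2

/-- Rescaling by a point `c` of `U` with nonzero coordinates turns convergence at `c` into
coefficients `a_α c^α` tending to `0`. Choosing `c` equal to `x` wherever `x_i ≠ 0` moves `x` to a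
point with coordinates `0` and `1`, where `analyticAt_tsum_of_tendsto` applies. -/
theorem ConvergesOn.analyticAt [CompleteSpace K] {f : MvPowerSeries (Fin n) K}
    {U : Set (Fin n → K)} (hf : ConvergesOn f U) (hU : IsOpen U) {x : Fin n → K} (hx : x ∈ U) :
    AnalyticAt K (psum f) x := by
  classical
  obtain ⟨ρ, hρ, hball⟩ := Metric.isOpen_iff.1 hU x hx
  obtain ⟨t, ht0, htρ⟩ := NormedField.exists_norm_lt K hρ
  rw [norm_pos_iff] at ht0
  let c : Fin n → K := fun i => if x i = 0 then t else x i
  let z : Fin n → ℕ := fun i => if x i = 0 then 0 else 1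
  have hc0 : ∀ i, c i ≠ 0 := by
    intro i
    by_cases h : x i = 0 <;> simp [c, h, ht0]
  have hcU : c ∈ U := by
    refine hball ?_
    rw [Metric.mem_ball, dist_pi_lt_iff hρ]
    intro i
    by_cases h : x i = 0 <;> simp [c, h, htρ, hρ]
  have hsum := (hf c hcU).tendsto_cofinite_zero
  have han := analyticAt_tsum_of_tendsto hsum z
  let D : (Fin n → K) →L[K] (Fin n → K) :=
    ContinuousLinearMap.pi fun i => (c i)⁻¹ • ContinuousLinearMap.proj i
  have hD : ∀ y i, D y i = (c i)⁻¹ * y i := fun y i => rfl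
  have hDx : D x = fun i => (z i : K) := by
    funext i
    rw [hD]
    by_cases h : x i = 0 <;> simp [c, z, h]
  rw [← hDx] at han
  refine (han.comp (D.analyticAt x)).congr (Eventually.of_forall fun y => ?_)
  simp only [Function.comp_apply, psum]
  refine tsum_congr fun α => ?_
  rw [mul_assoc, ← Finset.prod_mul_distrib]
  congr 1
  refine Finset.prod_congr rfl fun i _ => ?_
  rw [← mul_pow, hD, mul_inv_cancel_left₀ (hc0 i)]

end Analytic

/-! ### Evaluation of a wedge product. -/

section Wedge

variable {K : Type*} [NontriviallyNormedField K] {n m k : ℕ}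

/-- If the second form kills the first `m` vectors, only the trivial shuffle contributes. -/
theorem wedge_apply_of_forall_eq_zero (α : (Fin n → K) [⋀^Fin m]→ₗ[K] K)
    (β : (Fin n → K) [⋀^Fin k]→ₗ[K] K) (v : Fin (m + k) → Fin n → K)
    (hβ : ∀ (w : Fin k → Fin n → K) (i : Fin m) (j : Fin k), w j = v (Fin.castAdd k i) → β w = 0) :
    wedge α β v = α (fun i => v (Fin.castAdd k i)) * β (fun j => v (Fin.natAdd m j)) := by
  have h0 : wedge α β v = LinearMap.mul' K K
      ((∑ σ : Equiv.Perm.ModSumCongr (Fin m) (Fin k), AlternatingMap.domCoprod.summand α β σ)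
        (fun i => v (finSumFinEquiv i))) := rfl
  rw [h0, _root_.sum_apply, map_sum]
  refine (Fintype.sum_eq_single (Quotient.mk'' (1 : Equiv.Perm (Fin m ⊕ Fin k))) ?_).trans ?_
  rotate_left
  · rw [AlternatingMap.domCoprod.summand_mk'']
    simp [MultilinearMap.domDomCongr_apply, MultilinearMap.domCoprod_apply]
  · intro σ hσ
    induction σ using Quotient.inductionOn' with | _ σ
    rw [AlternatingMap.domCoprod.summand_mk'', _root_.smul_apply,
      MultilinearMap.domDomCongr_apply, MultilinearMap.domCoprod_apply]
    suffices h : β (fun j => v (finSumFinEquiv (σ (Sum.inr j)))) = 0 by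
      simp [h]
    -- Either `σ` feeds one of the first `m` vectors to `β`, which kills the term, or it preserves
    -- both blocks and represents the trivial coset.
    by_cases hex : ∃ i j, σ (Sum.inr j) = Sum.inl i
    · obtain ⟨i, j, hij⟩ := hex
      exact hβ _ i j (by simp [hij])
    · exfalso
      refine hσ ?_
      have hex' : ∀ j, ∃ j', σ (Sum.inr j) = Sum.inr j' := by
        intro j
        rcases hs : σ (Sum.inr j) with i | j'
        · exact absurd ⟨i, j, hs⟩ hex
        · exact ⟨j', rfl⟩
      choose g hg using hex'
      have hginj : Function.Injective g := by
        intro a b hab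
        have : σ (Sum.inr a) = σ (Sum.inr b) := by rw [hg, hg, hab]
        simpa using this
      have hgsurj := Finite.surjective_of_injective hginj
      have hmem : σ ∈ (Equiv.Perm.sumCongrHom (Fin m) (Fin k)).range := by
        refine Equiv.Perm.mem_sumCongrHom_range_of_perm_mapsTo_inl ?_
        rintro _ ⟨i, rfl⟩
        rcases hs : σ (Sum.inl i) with i' | j'
        · exact ⟨i', rfl⟩
        · obtain ⟨j, rfl⟩ := hgsurj j'
          rw [← hg j] at hs
          exact absurd (σ.injective hs) (by simp)
      refine Quotient.sound' ?_
      rw [QuotientGroup.leftRel_apply]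
      simpa using hmem

end Wedge

/-! ### Straightening a zero locus while controlling Haar measure. -/

section Splitting

variable {K : Type*} [NontriviallyNormedField K] {n m k : ℕ}

theorem coprod_eq_mulVec (T : (Fin m → K) →ₗ[K] (Fin n → K)) (s : (Fin k → K) →ₗ[K] (Fin n → K))
    (y : Fin m → K) (u : Fin k → K) :
    (Matrix.of (Fin.append (fun i => T (Pi.single i 1)) fun j => s (Pi.single j 1))).transpose.mulVec
      (Fin.append y u) = T y + s u := by
  have hsingle : ∀ {d : ℕ} (i : Fin d), (fun j => if i = j then (1 : K) else 0) = Pi.single i 1 := by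
    intro d i; funext j; simp [Pi.single_apply, eq_comm]
  funext l
  simp only [Matrix.mulVec, dotProduct, Fin.sum_univ_add, Matrix.transpose_apply, Matrix.of_apply,
    Fin.append_left, Fin.append_right, Pi.add_apply]
  congr 1
  · conv_rhs => rw [LinearMap.pi_apply_eq_sum_univ T y]
    simp [Finset.sum_apply, mul_comm, hsingle]
  · conv_rhs => rw [LinearMap.pi_apply_eq_sum_univ s u]
    simp [Finset.sum_apply, mul_comm, hsingle]

theorem volForm_append_ne_zero (T : (Fin m → K) →ₗ[K] (Fin (m + k) → K))
    (s : (Fin k → K) →ₗ[K] (Fin (m + k) → K))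
    (hinj : ∀ y u, T y + s u = 0 → y = 0 ∧ u = 0) :
    volForm K (m + k) (Fin.append (fun i => T (Pi.single i 1)) fun j => s (Pi.single j 1)) ≠ 0 := by
  intro h
  have hdet : (Matrix.of (Fin.append (fun i => T (Pi.single i 1))
      fun j => s (Pi.single j 1))).transpose.det = 0 := by
    rw [Matrix.det_transpose]; exact h
  obtain ⟨w, hw, hMw⟩ := Matrix.exists_mulVec_eq_zero_iff.2 hdet
  refine hw ?_
  rw [← Fin.append_castAdd_natAdd (f := w), coprod_eq_mulVec] at hMw
  obtain ⟨h1, h2⟩ := hinj _ _ hMw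
  rw [← Fin.append_castAdd_natAdd (f := w), h1, h2]
  funext l
  refine Fin.addCases (fun i => ?_) (fun i => ?_) l <;> simp

variable [IsUltrametricDist K] [ProperSpace K]
  {π : RK K} [MeasurableSpace K] [BorelSpace K] {ν : Measure K} [ν.IsAddHaarMeasure]

theorem measurePreserving_append :
    MeasurePreserving (fun p : (Fin m → K) × (Fin k → K) => Fin.append p.1 p.2)
      ((Measure.pi fun _ => ν).prod (Measure.pi fun _ => ν)) (Measure.pi fun _ => ν) := by
  have hm : Measurable (fun p : (Fin m → K) × (Fin k → K) => Fin.append p.1 p.2) := by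
    refine measurable_pi_lambda _ fun l => ?_
    refine Fin.addCases (fun i => ?_) (fun i => ?_) l
    · simp only [Fin.append_left]; fun_prop
    · simp only [Fin.append_right]; fun_prop
  refine ⟨hm, (Measure.pi_eq fun s hs => ?_).symm⟩
  rw [Measure.map_apply hm (MeasurableSet.univ_pi hs)]
  have : (fun p : (Fin m → K) × (Fin k → K) => Fin.append p.1 p.2) ⁻¹' Set.univ.pi s =
      (Set.univ.pi fun i => s (Fin.castAdd k i)) ×ˢ (Set.univ.pi fun j => s (Fin.natAdd m j)) := by
    ext p
    simp only [Set.mem_preimage, Set.mem_univ_pi, Set.mem_prod]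
    constructor
    · intro h
      exact ⟨fun i => by simpa using h (Fin.castAdd k i), fun i => by simpa using h (Fin.natAdd m i)⟩
    · rintro ⟨h1, h2⟩ l
      refine Fin.addCases (fun i => ?_) (fun i => ?_) l
      · simpa using h1 i
      · simpa using h2 i
  rw [this, Measure.prod_prod, Measure.pi_pi, Measure.pi_pi, Fin.prod_univ_add]

theorem smul_map_coprod (hπ : Irreducible π) (hnorm : ‖(π : K)‖ = (q K : ℝ)⁻¹)
    (hν : ν (RK K : Set K) = 1) (T : (Fin m → K) →ₗ[K] (Fin (m + k) → K))
    (s : (Fin k → K) →ₗ[K] (Fin (m + k) → K))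
    (hD : volForm K (m + k)
      (Fin.append (fun i => T (Pi.single i 1)) fun j => s (Pi.single j 1)) ≠ 0) :
    ‖volForm K (m + k)
      (Fin.append (fun i => T (Pi.single i 1)) fun j => s (Pi.single j 1))‖ₑ •
      Measure.map (fun p : (Fin m → K) × (Fin k → K) => T p.1 + s p.2)
        ((Measure.pi fun _ => ν).prod (Measure.pi fun _ => ν)) = Measure.pi fun _ => ν := by
  set M := (Matrix.of (Fin.append (fun i => T (Pi.single i 1))
      fun j => s (Pi.single j 1))).transpose with hM
  have hdet : M.det = volForm K (m + k)
      (Fin.append (fun i => T (Pi.single i 1)) fun j => s (Pi.single j 1)) := by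
    rw [hM, Matrix.det_transpose]; rfl
  have hcomp : (fun p : (Fin m → K) × (Fin k → K) => T p.1 + s p.2) =
      Matrix.toLin' M ∘ fun p => Fin.append p.1 p.2 := by
    funext p
    rw [Function.comp_apply, Matrix.toLin'_apply, hM, coprod_eq_mulVec]
  have happ := measurePreserving_append (ν := ν) (m := m) (k := k)
  rw [hcomp, ← Measure.map_map (Continuous.measurable (LinearMap.continuous_on_pi _))
    happ.measurable, happ.map_eq, ← hdet]
  exact smul_map_matrix_pi hπ hnorm hν (by rwa [hdet])

theorem isUltrametricDist_prod {X Y : Type*} [PseudoMetricSpace X] [PseudoMetricSpace Y]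
    [IsUltrametricDist X] [IsUltrametricDist Y] : IsUltrametricDist (X × Y) := by
  refine ⟨fun a b c => ?_⟩
  simp only [Prod.dist_eq]
  refine max_le ((dist_triangle_max _ b.1 _).trans ?_) ((dist_triangle_max _ b.2 _).trans ?_)
  · exact max_le_max (le_max_left _ _) (le_max_left _ _)
  · exact max_le_max (le_max_right _ _) (le_max_right _ _)

/-- Straightening: if `F` vanishes along an immersion `φ`, and `s` is a section of the derivative
of `F`, then near `(y₀, 0)` the map `(y, u) ↦ φ y + s u` scales the Haar measure by a constant and
transforms the norm of `F` to the norm of `u`. -/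
theorem exists_straightening (hπ : Irreducible π) (hnorm : ‖(π : K)‖ = (q K : ℝ)⁻¹)
    (hν : ν (RK K : Set K) = 1) {φ : (Fin m → K) → (Fin (m + k) → K)}
    {F : (Fin (m + k) → K) → (Fin k → K)} {y₀ : Fin m → K}
    {T : (Fin m → K) →L[K] (Fin (m + k) → K)} {A : (Fin (m + k) → K) →L[K] (Fin k → K)}
    {s : (Fin k → K) →L[K] (Fin (m + k) → K)}
    (hφ : HasStrictFDerivAt φ T y₀) (hF : HasStrictFDerivAt F A (φ y₀))
    (hT : Function.Injective T) (hAT : ∀ y, A (T y) = 0) (hAs : ∀ u, A (s u) = u)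
    {N : Set (Fin m → K)} (hN : N ∈ 𝓝 y₀) (hFφ : ∀ y ∈ N, F (φ y) = 0)
    {N' : Set (Fin (m + k) → K)} (hN' : N' ∈ 𝓝 (φ y₀)) :
    ∃ ρ > 0, ∃ W : Set (Fin (m + k) → K), IsOpen W ∧ IsCompact W ∧ φ y₀ ∈ W ∧ W ⊆ N' ∧
      Metric.closedBall y₀ ρ ⊆ N ∧
      W = (fun p : (Fin m → K) × (Fin k → K) => φ p.1 + s p.2) ''
        (Metric.closedBall y₀ ρ ×ˢ Metric.closedBall 0 ρ) ∧
      ContinuousOn (fun p : (Fin m → K) × (Fin k → K) => φ p.1 + s p.2)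
        (Metric.closedBall y₀ ρ ×ˢ Metric.closedBall 0 ρ) ∧
      (∀ p ∈ Metric.closedBall y₀ ρ ×ˢ Metric.closedBall (0 : Fin k → K) ρ,
        ‖F (φ p.1 + s p.2)‖ = ‖p.2‖) ∧
      ‖volForm K (m + k)
        (Fin.append (fun i => T (Pi.single i 1)) fun j => s (Pi.single j 1))‖ₑ •
        Measure.map (fun p : (Fin m → K) × (Fin k → K) => φ p.1 + s p.2)
        (((Measure.pi fun _ => ν).restrict (Metric.closedBall y₀ ρ)).prod
          ((Measure.pi fun _ => ν).restrict (Metric.closedBall 0 ρ))) =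
        (Measure.pi fun _ => ν).restrict W := by
  have : IsUltrametricDist ((Fin m → K) × (Fin k → K)) := isUltrametricDist_prod
  have : ((Measure.pi fun _ : Fin m => ν).prod (Measure.pi fun _ : Fin k => ν)).IsAddHaarMeasure :=
    Measure.prod.instIsAddHaarMeasure _ _
  have hinj : ∀ y u, T y + s u = 0 → y = 0 ∧ u = 0 := by
    intro y u h
    have h1 := congrArg A h
    rw [map_add, hAT, hAs, zero_add, map_zero] at h1
    rw [h1, map_zero, add_zero] at h
    exact ⟨hT (h.trans (map_zero T).symm), h1⟩
  have hD := volForm_append_ne_zero (T : (Fin m → K) →ₗ[K] (Fin (m + k) → K))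
    (s : (Fin k → K) →ₗ[K] (Fin (m + k) → K)) hinj
  have hmapL := smul_map_coprod hπ hnorm hν (T : (Fin m → K) →ₗ[K] (Fin (m + k) → K))
    (s : (Fin k → K) →ₗ[K] (Fin (m + k) → K)) hD
  -- `T` spans tangent directions killed by `A`, while `s` is a section of `A`, so the sum is
  -- injective; equal dimensions make it bijective.
  let Llin : ((Fin m → K) × (Fin k → K)) ≃ₗ[K] (Fin (m + k) → K) :=
    LinearMap.linearEquivOfInjective
      ((T.coprod s : (Fin m → K) × (Fin k → K) →L[K] (Fin (m + k) → K)) :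
        (Fin m → K) × (Fin k → K) →ₗ[K] (Fin (m + k) → K))
      (by
        rw [← LinearMap.ker_eq_bot, LinearMap.ker_eq_bot']
        rintro ⟨y, u⟩ h
        obtain ⟨h1, h2⟩ := hinj y u (by simpa using h)
        rw [h1, h2]; rfl)
      (by simp)
  let L := Llin.toContinuousLinearEquiv
  have hL : ∀ p, L p = T p.1 + s p.2 := fun p => rfl
  let Ψ : (Fin m → K) × (Fin k → K) → (Fin (m + k) → K) := fun p => φ p.1 + s p.2
  let z₀ : (Fin m → K) × (Fin k → K) := (y₀, 0)
  have hΨ0 : Ψ z₀ = φ y₀ := by simp [Ψ, z₀]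
  have hΨ : HasStrictFDerivAt Ψ (L : (Fin m → K) × (Fin k → K) →L[K] (Fin (m + k) → K)) z₀ := by
    have h1 : HasStrictFDerivAt (fun p : (Fin m → K) × (Fin k → K) => φ p.1)
        (T.comp (ContinuousLinearMap.fst K _ _)) z₀ :=
      HasStrictFDerivAt.comp z₀ hφ hasStrictFDerivAt_fst
    have h2 : HasStrictFDerivAt (fun p : (Fin m → K) × (Fin k → K) => s p.2)
        (s.comp (ContinuousLinearMap.snd K _ _)) z₀ :=
      HasStrictFDerivAt.comp z₀ s.hasStrictFDerivAt hasStrictFDerivAt_snd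
    refine (h1.add h2).congr_fderiv ?_
    ext p <;> simp [hL]
  let H : (Fin m → K) × (Fin k → K) → (Fin m → K) × (Fin k → K) := fun p => L.symm (Ψ p)
  have hH : HasStrictFDerivAt H (ContinuousLinearMap.id K _) z₀ := by
    have := (L.symm : (Fin (m + k) → K) →L[K] (Fin m → K) × (Fin k → K)).hasStrictFDerivAt.comp z₀ hΨ
    refine this.congr_fderiv ?_
    ext p <;> simp
  have hG : HasStrictFDerivAt (fun p => F (Ψ p)) (ContinuousLinearMap.snd K (Fin m → K) (Fin k → K))
      z₀ := by
    rw [← hΨ0] at hF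
    refine (hF.comp z₀ hΨ).congr_fderiv ?_
    ext p <;> simp [hL, hAT, hAs]
  -- Any constant below `1` would serve: the error must be strictly smaller than the main term.
  have hhalf : (0 : NNReal) < 1 / 2 := by norm_num
  obtain ⟨S1, hS1, hHapp⟩ := hH.approximates_deriv_on_nhds (Or.inr hhalf)
  obtain ⟨S2, hS2, hGapp⟩ := hG.approximates_deriv_on_nhds (Or.inr hhalf)
  have hS3 : Ψ ⁻¹' N' ∈ 𝓝 z₀ := hΨ.continuousAt.preimage_mem_nhds (by rwa [hΨ0])
  have hS4 : Prod.fst ⁻¹' N ∈ 𝓝 z₀ := continuousAt_fst.preimage_mem_nhds hN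
  obtain ⟨ρ, hρ, hball⟩ := Metric.nhds_basis_closedBall.mem_iff.1
    (inter_mem (inter_mem hS1 hS2) (inter_mem hS3 hS4))
  have hprod : Metric.closedBall y₀ ρ ×ˢ Metric.closedBall (0 : Fin k → K) ρ =
      Metric.closedBall z₀ ρ := closedBall_prod_same _ _ _
  have hz₀ : z₀ ∈ Metric.closedBall z₀ ρ := Metric.mem_closedBall_self hρ.le
  have hHB : ∀ x ∈ Metric.closedBall z₀ ρ, ∀ y ∈ Metric.closedBall z₀ ρ,
      ‖H x - H y - (x - y)‖ ≤ 1 / 2 * ‖x - y‖ := by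
    intro x hx y hy
    simpa using! hHapp x (hball hx).1.1 y (hball hy).1.1
  obtain ⟨hiso, hsurj⟩ := isometry_of_approx_id hHB
  have hLH : ∀ p, L (H p) = Ψ p := fun p => L.apply_symm_apply _
  have hΨcont : ContinuousOn Ψ (Metric.closedBall z₀ ρ) := by
    have hHc : ContinuousOn H (Metric.closedBall z₀ ρ) := by
      refine LipschitzOnWith.continuousOn (K := 1) ?_
      refine LipschitzOnWith.of_dist_le_mul fun x hx y hy => ?_
      simp [dist_eq_norm, hiso x hx y hy]
    exact (L.continuous.comp_continuousOn hHc).congr fun p _ => (hLH p).symm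
  have hHimage : H '' Metric.closedBall z₀ ρ = Metric.closedBall (H z₀) ρ := by
    refine Set.Subset.antisymm ?_ hsurj
    rintro _ ⟨x, hx, rfl⟩
    rw [Metric.mem_closedBall, dist_eq_norm, hiso x hx z₀ hz₀, ← dist_eq_norm]
    exact hx
  have hW : Ψ '' Metric.closedBall z₀ ρ = L '' Metric.closedBall (H z₀) ρ := by
    rw [← hHimage, Set.image_image]
    exact Set.image_congr fun p _ => (hLH p).symm
  refine ⟨ρ, hρ, Ψ '' Metric.closedBall z₀ ρ, ?_, ?_, ⟨z₀, hz₀, hΨ0⟩, ?_, ?_, by rw [hprod],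
    by rw [hprod]; exact hΨcont, ?_, ?_⟩
  · rw [hW]
    exact L.toHomeomorph.isOpenMap _ (IsUltrametricDist.isOpen_closedBall _ hρ.ne')
  · exact (isCompact_closedBall z₀ ρ).image_of_continuousOn hΨcont
  · rintro _ ⟨x, hx, rfl⟩
    exact (hball hx).2.1
  · intro y hy
    have hy' : (y, (0 : Fin k → K)) ∈ Metric.closedBall z₀ ρ := by
      rw [← hprod]; exact ⟨hy, Metric.mem_closedBall_self hρ.le⟩
    exact (hball hy').2.2
  · rw [hprod]
    intro p hp
    have hp0 : (p.1, (0 : Fin k → K)) ∈ Metric.closedBall z₀ ρ := by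
      rw [← hprod] at hp ⊢
      exact ⟨hp.1, Metric.mem_closedBall_self hρ.le⟩
    have hF0 : F (Ψ (p.1, 0)) = 0 := by
      have := hFφ p.1 (hball hp0).2.2
      simpa [Ψ] using this
    -- Comparing `p` with `(p.1, 0)`, where `F ∘ Ψ` vanishes, bounds `F (Ψ p) - p.2` by half of
    -- `‖p.2‖`.
    have happ := hGapp p (hball hp).1.2 (p.1, 0) (hball hp0).1.2
    have hsub : p - (p.1, 0) = (0, p.2) := by ext <;> simp
    beta_reduce at happ
    rw [hF0, sub_zero, hsub] at happ
    have hn : ‖((0 : Fin m → K), p.2)‖ = ‖p.2‖ := by simp [Prod.norm_def]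
    rw [hn] at happ
    rcases eq_or_ne p.2 0 with h0 | h0
    · have : p = (p.1, 0) := by rw [← h0]
      rw [h0, norm_zero, norm_eq_zero]
      simpa [Ψ] using hF0
    · refine norm_eq_of_norm_sub_lt (lt_of_le_of_lt happ ?_)
      have := norm_pos_iff.2 h0
      simp only [NNReal.coe_div, NNReal.coe_one, NNReal.coe_ofNat]
      linarith
  · have hLm : Measurable L := L.continuous.measurable
    rw [Measure.prod_restrict, hprod]
    -- `H` preserves Haar measure between balls, so the whole scaling factor comes from the linear
    -- map `L`.
    have hcomp : (fun p : (Fin m → K) × (Fin k → K) => φ p.1 + s p.2) = L ∘ H :=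
      funext fun p => (hLH p).symm
    have hHae : AEMeasurable H (((Measure.pi fun _ : Fin m => ν).prod
        (Measure.pi fun _ : Fin k => ν)).restrict (Metric.closedBall z₀ ρ)) := by
      have hHc : ContinuousOn H (Metric.closedBall z₀ ρ) :=
        L.symm.continuous.comp_continuousOn hΨcont
      exact hHc.aemeasurable measurableSet_closedBall
    rw [hcomp, ← AEMeasurable.map_map_of_aemeasurable hLm.aemeasurable hHae,
      map_restrict_closedBall_eq (μ := (Measure.pi fun _ : Fin m => ν).prod
        (Measure.pi fun _ : Fin k => ν)) hρ hiso hsurj]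
    have hpre : Metric.closedBall (H z₀) ρ = L ⁻¹' (Ψ '' Metric.closedBall z₀ ρ) := by
      rw [hW, Set.preimage_image_eq _ L.injective]
    have hWm : MeasurableSet (Ψ '' Metric.closedBall z₀ ρ) :=
      ((isCompact_closedBall z₀ ρ).image_of_continuousOn hΨcont).measurableSet
    rw [hpre, ← Measure.restrict_map hLm hWm, ← Measure.restrict_smul]
    congr 1

end Splitting

/-! ### The functions `δ_r` as an approximate identity. -/

section Delta

variable {K : Type*} [NontriviallyNormedField K] [IsUltrametricDist K] {π : RK K} {m k : ℕ}

theorem deltaApprox_congr_norm (hπ : Irreducible π) (r : ℕ) {u v : Fin k → K} (h : ‖u‖ = ‖v‖) :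
    deltaApprox π r u = deltaApprox π r v := by
  classical
  rw [deltaApprox_eq hπ, deltaApprox_eq hπ, Set.indicator_apply, Set.indicator_apply]
  simp only [mem_closedBall_zero_iff, h]

theorem continuous_deltaApprox (hπ : Irreducible π) (r : ℕ) :
    Continuous (deltaApprox π r : (Fin k → K) → ℂ) := by
  have : (deltaApprox π r : (Fin k → K) → ℂ) = _ := funext fun u => deltaApprox_eq hπ r u
  rw [this]
  refine Continuous.indicator (fun a ha => ?_) continuous_const
  rw [IsUltrametricDist.frontier_closedBall_eq_empty (0 : Fin k → K)
    (pow_pos (norm_uniformizer_pos hπ) r).ne'] at ha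
  exact ha.elim

variable [ProperSpace K] [MeasurableSpace K] [BorelSpace K] {ν : Measure K} [ν.IsAddHaarMeasure]

theorem integral_indicator_closedBall_pow (hπ : Irreducible π)
    (hnorm : ‖(π : K)‖ = (q K : ℝ)⁻¹) (hν : ν (RK K : Set K) = 1) {ρ : ℝ} {r : ℕ}
    (hr : ‖(π : K)‖ ^ r ≤ ρ) {E : Type*} [NormedAddCommGroup E] [NormedSpace ℝ E] [CompleteSpace E]
    (c : E) :
    ∫ u in Metric.closedBall (0 : Fin k → K) ρ,
      (Metric.closedBall (0 : Fin k → K) (‖(π : K)‖ ^ r)).indicator (fun _ => c) u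
        ∂(Measure.pi fun _ => ν) = ((q K : ℝ) ^ (r * k))⁻¹ • c := by
  rw [integral_indicator measurableSet_closedBall,
    Measure.restrict_restrict measurableSet_closedBall,
    Set.inter_eq_left.2 (Metric.closedBall_subset_closedBall hr), setIntegral_const,
    measureReal_def, measure_pi_closedBall_pow hπ hnorm hν]
  simp

/-- Once its support lies in the ball, `δ_r` has integral `1`. Uniform continuity of `G` on the
compact product then bounds the error of replacing `G (y, u)` by `G (y, 0)`. -/
theorem tendsto_integral_prod_deltaApprox (hπ : Irreducible π)
    (hnorm : ‖(π : K)‖ = (q K : ℝ)⁻¹) (hν : ν (RK K : Set K) = 1) {y₀ : Fin m → K} {ρ : ℝ}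
    (hρ : 0 < ρ) {G : (Fin m → K) × (Fin k → K) → ℂ}
    (hG : ContinuousOn G (Metric.closedBall y₀ ρ ×ˢ Metric.closedBall 0 ρ)) :
    Tendsto (fun r => ∫ p, G p * deltaApprox π r p.2
        ∂(((Measure.pi fun _ => ν).restrict (Metric.closedBall y₀ ρ)).prod
          ((Measure.pi fun _ => ν).restrict (Metric.closedBall 0 ρ)))) atTop
      (𝓝 (∫ y in Metric.closedBall y₀ ρ, G (y, 0) ∂(Measure.pi fun _ => ν))) := by
  have hq0 : (q K : ℝ) ≠ 0 := by exact_mod_cast q_ne_zero hπ hnorm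
  have hq0' : (q K : ℂ) ≠ 0 := by exact_mod_cast q_ne_zero hπ hnorm
  set BX := Metric.closedBall y₀ ρ
  set BY := Metric.closedBall (0 : Fin k → K) ρ
  set μX : Measure (Fin m → K) := Measure.pi fun _ => ν
  set μY : Measure (Fin k → K) := Measure.pi fun _ => ν
  have hBX : IsCompact BX := isCompact_closedBall _ _
  have hB : IsCompact (BX ×ˢ BY) := hBX.prod (isCompact_closedBall _ _)
  have hBm : MeasurableSet (BX ×ˢ BY) := hB.measurableSet
  have hfinX : μX BX < ∞ := hBX.measure_lt_top
  have h0Y : (0 : Fin k → K) ∈ BY := Metric.mem_closedBall_self hρ.le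
  have huc := hB.uniformContinuousOn_of_continuous hG
  have hGX : ContinuousOn (fun p : (Fin m → K) × (Fin k → K) => G (p.1, 0)) (BX ×ˢ BY) :=
    hG.comp (by fun_prop) fun p hp => ⟨hp.1, h0Y⟩
  have hint : ∀ (r : ℕ) {G' : (Fin m → K) × (Fin k → K) → ℂ}, ContinuousOn G' (BX ×ˢ BY) →
      Integrable (fun p => G' p * deltaApprox π r p.2) ((μX.restrict BX).prod (μY.restrict BY)) := by
    intro r G' hG'
    rw [Measure.prod_restrict]
    refine ContinuousOn.integrableOn_compact hB (hG'.mul ?_)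
    exact ((continuous_deltaApprox hπ r).comp continuous_snd).continuousOn
  rw [Metric.tendsto_atTop]
  intro ε hε
  -- The `+ 1` keeps the denominator positive and makes the final inequality strict.
  set δ := ε / (μX.real BX + 1) with hδ
  have hvol : 0 ≤ μX.real BX := measureReal_nonneg
  have hδ0 : 0 < δ := by positivity
  obtain ⟨η, hη, hηG⟩ := Metric.uniformContinuousOn_iff_le.1 huc δ hδ0
  obtain ⟨R, hR⟩ : ∃ R : ℕ, ‖(π : K)‖ ^ R ≤ min η ρ :=
    ((tendsto_pow_atTop_nhds_zero_of_lt_one (norm_nonneg _)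
      (norm_uniformizer_lt_one hπ)).eventually (ge_mem_nhds (lt_min hη hρ))).exists
  refine ⟨R, fun r hr => ?_⟩
  have hr' : ‖(π : K)‖ ^ r ≤ min η ρ :=
    (pow_le_pow_of_le_one (norm_nonneg _) (norm_uniformizer_lt_one hπ).le hr).trans hR
  have hrη := hr'.trans (min_le_left _ _)
  have hrρ := hr'.trans (min_le_right _ _)
  have hδint : ∫ u in BY, deltaApprox π r u ∂μY = 1 := by
    simp_rw [deltaApprox_eq hπ]
    rw [integral_indicator_closedBall_pow hπ hnorm hν hrρ]
    simp [hq0']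
  have hδnorm : ∫ u in BY, ‖deltaApprox π r u‖ ∂μY = 1 := by
    simp_rw [deltaApprox_eq hπ, norm_indicator_eq_indicator_norm]
    rw [integral_indicator_closedBall_pow hπ hnorm hν hrρ]
    simp [hq0]
  have hlim : ∫ y in BX, G (y, 0) ∂μX =
      ∫ p, G (p.1, 0) * deltaApprox π r p.2 ∂((μX.restrict BX).prod (μY.restrict BY)) := by
    rw [integral_prod_mul (fun y => G (y, 0)) (deltaApprox π r), hδint, mul_one]
  rw [hlim, dist_eq_norm, ← integral_sub (hint r hG) (hint r hGX)]
  have hbound : ∀ᵐ p ∂((μX.restrict BX).prod (μY.restrict BY)),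
      ‖G p * deltaApprox π r p.2 - G (p.1, 0) * deltaApprox π r p.2‖ ≤
        δ * ‖deltaApprox π r p.2‖ := by
    rw [Measure.prod_restrict]
    refine ae_restrict_of_forall_mem hBm fun p hp => ?_
    rw [← sub_mul, norm_mul]
    by_cases hp2 : p.2 ∈ Metric.closedBall (0 : Fin k → K) (‖(π : K)‖ ^ r)
    · gcongr
      rw [← dist_eq_norm]
      refine hηG p hp (p.1, 0) ⟨hp.1, h0Y⟩ ?_
      rw [Prod.dist_eq]
      simpa [hη.le] using (mem_closedBall_zero_iff.1 hp2).trans hrη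
    · rw [deltaApprox_eq hπ, Set.indicator_of_notMem hp2]
      simp
  have hbint : Integrable (fun p : (Fin m → K) × (Fin k → K) => δ * ‖deltaApprox π r p.2‖)
      ((μX.restrict BX).prod (μY.restrict BY)) := by
    have := hint r (G' := fun _ => 1) continuousOn_const
    simpa using this.norm.const_mul δ
  refine (norm_integral_le_of_norm_le hbint hbound).trans_lt ?_
  rw [integral_prod_mul (fun _ => δ) fun u => ‖deltaApprox π r u‖, hδnorm, mul_one]
  simp only [integral_const, measureReal_restrict_apply MeasurableSet.univ, Set.univ_inter,
    smul_eq_mul]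
  rw [hδ, mul_div_assoc', div_lt_iff₀ (by positivity)]
  nlinarith

end Delta

/-! ### Continuity of a differential form along moving vectors. -/

section FormContinuity

variable {K : Type*} [NontriviallyNormedField K] {n m : ℕ}

/-- Continuity is assumed only for each fixed tuple of vectors. Expanding in the standard basis
reduces moving tuples to finitely many fixed ones. -/
theorem continuousAt_form_apply {X : Type*} [TopologicalSpace X]
    {γ : (Fin n → K) → (Fin n → K) [⋀^Fin m]→ₗ[K] K} {φ : X → Fin n → K} {w : X → Fin m → Fin n → K}
    {y : X} (hγ : ∀ v, ContinuousAt (fun z => γ z v) (φ y)) (hφ : ContinuousAt φ y)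
    (hw : ContinuousAt w y) : ContinuousAt (fun z => γ (φ z) (w z)) y := by
  have key : ∀ z v, γ z v =
      ∑ j : Fin m → Fin n, (∏ i, v i (j i)) * γ z fun i => Pi.single (j i) (1 : K) := by
    intro z v
    have hv : v = fun i => ∑ l, v i l • (Pi.single l (1 : K) : Fin n → K) := by
      funext i l
      simp [Finset.sum_apply, Pi.single_apply]
    conv_lhs => rw [hv]
    rw [← AlternatingMap.coe_multilinearMap, MultilinearMap.map_sum]
    refine Finset.sum_congr rfl fun j _ => ?_
    rw [MultilinearMap.map_smul_univ, smul_eq_mul]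
  have hfun : (fun z => γ (φ z) (w z)) = fun z =>
      ∑ j : Fin m → Fin n, (∏ i, w z i (j i)) * γ (φ z) fun i => Pi.single (j i) (1 : K) :=
    funext fun z => key _ _
  rw [hfun]
  refine tendsto_finsetSum _ fun j _ => ?_
  refine Tendsto.mul (tendsto_finsetProd _ fun i _ => ?_) ((hγ _).comp hφ)
  exact (continuous_apply (j i)).continuousAt.comp
    ((continuous_apply i).continuousAt.comp hw)

end FormContinuity

/-! ### The limit formula near a point of a parametrization. -/

section LocalLimit

variable {K : Type*} [NontriviallyNormedField K] [IsUltrametricDist K] [ProperSpace K] {m k : ℕ}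
  {U V : Set (Fin (m + k) → K)} {f : Fin k → MvPowerSeries (Fin (m + k)) K}
  {γ : (Fin (m + k) → K) → (Fin (m + k) → K) [⋀^Fin m]→ₗ[K] K}

theorem analyticAt_pmap (hUo : IsOpen U) (hf : ∀ i, ConvergesOn (f i) U)
    {x : Fin (m + k) → K} (hx : x ∈ U) : AnalyticAt K (pmap f) x :=
  AnalyticAt.pi fun i => (hf i).analyticAt hUo hx

theorem fderiv_pmap_surjective (hUo : IsOpen U) (hf : ∀ i, ConvergesOn (f i) U)
    {x : Fin (m + k) → K} (hx : x ∈ U) (hrank : (jacobian f x).rank = k) :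
    Function.Surjective (fderiv K (pmap f) x) := by
  have hcoord : ∀ i w, fderiv K (pmap f) x w i = fderiv K (psum (f i)) x w := by
    intro i w
    have : HasFDerivAt (pmap f) (ContinuousLinearMap.pi fun i => fderiv K (psum (f i)) x) x :=
      hasFDerivAt_pi.2 fun i => ((hf i).analyticAt hUo hx).differentiableAt.hasFDerivAt
    rw [this.fderiv]; rfl
  have hJ : jacobian f x = LinearMap.toMatrix'
      (fderiv K (pmap f) x : (Fin (m + k) → K) →ₗ[K] (Fin k → K)) := by
    ext i j
    rw [LinearMap.toMatrix'_apply]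
    simp [jacobian, hcoord]
  have hrange : LinearMap.range (fderiv K (pmap f) x : (Fin (m + k) → K) →ₗ[K] (Fin k → K)) = ⊤ := by
    refine Submodule.eq_top_of_finrank_eq ?_
    rw [hJ, Matrix.rank, ← Matrix.toLin'_apply', Matrix.toLin'_toMatrix'] at hrank
    rw [hrank]; simp
  exact LinearMap.range_eq_top.1 hrange

theorem exists_section {x : Fin (m + k) → K}
    (hA : Function.Surjective (fderiv K (pmap f) x)) :
    ∃ s : (Fin k → K) →L[K] (Fin (m + k) → K), ∀ u, fderiv K (pmap f) x (s u) = u := by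
  obtain ⟨s, hs⟩ := LinearMap.exists_rightInverse_of_surjective
    (fderiv K (pmap f) x : (Fin (m + k) → K) →ₗ[K] (Fin k → K)) (LinearMap.range_eq_top.2 hA)
  exact ⟨LinearMap.toContinuousLinearMap s, fun u => LinearMap.congr_fun hs u⟩

/-- The value of a Gel'fand–Leray form on a basis of the tangent space. -/
theorem IsGelfandLeray.apply_eq (hγ : IsGelfandLeray f V γ) {x : Fin (m + k) → K} (hx : x ∈ V)
    {T : (Fin m → K) → (Fin (m + k) → K)} {s : (Fin k → K) → (Fin (m + k) → K)}
    (hAT : ∀ y, fderiv K (pmap f) x (T y) = 0) (hAs : ∀ u, fderiv K (pmap f) x (s u) = u) :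
    γ x (fun i => T (Pi.single i 1)) = volForm K (m + k)
        (Fin.append (fun i => T (Pi.single i 1)) fun j => s (Pi.single j 1)) := by
  -- On this tuple the wedge collapses to one product, since the differentials of `f` kill each `T
  -- e_i`. The second factor is the determinant of the identity, because `s` is a section.
  have h := congrArg (fun Θ => Θ (Fin.append (fun i => T (Pi.single i 1))
    fun j => s (Pi.single j 1))) (hγ.wedge_eq x hx)
  beta_reduce at h
  rw [← h, wedge_apply_of_forall_eq_zero]
  · simp only [Fin.append_left, Fin.append_right]
    have hone : wedgeDiff (pmap f) x (fun j => s (Pi.single j 1)) = 1 := by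
      have : wedgeDiff (pmap f) x (fun j => s (Pi.single j 1)) =
          Matrix.det (Matrix.of fun j => fderiv K (pmap f) x (s (Pi.single j 1))) := rfl
      rw [this]
      have h1 : (Matrix.of fun j => fderiv K (pmap f) x (s (Pi.single j 1))) = 1 := by
        ext i j
        simp [hAs, Matrix.one_apply, Pi.single_apply, eq_comm]
      rw [h1, Matrix.det_one]
    rw [hone, mul_one]
  · intro w i j hw
    refine (volForm K k).map_coord_zero j ?_
    rw [hw, Fin.append_left]
    exact hAT _

variable {π : RK K} [MeasurableSpace K] [BorelSpace K] {ν : Measure K} [ν.IsAddHaarMeasure]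

/-- Near every point of a parametrized open subset of `V`, the measures `δ_r (f (x)) |dx|` converge
to the measure that the Gel'fand–Leray form induces in the parametrization. -/
theorem Parametrization.exists_local_limit (hπ : Irreducible π) (hnorm : ‖(π : K)‖ = (q K : ℝ)⁻¹)
    (hν : ν (RK K : Set K) = 1) (hUo : IsOpen U) (hf : ∀ i, ConvergesOn (f i) U)
    (hV : V = zeroLocus f U) (hrank : ∀ x ∈ V, (jacobian f x).rank = k)
    (hγ : IsGelfandLeray f V γ) (φ : Parametrization V m) {y₀ : Fin m → K} (hy₀ : y₀ ∈ φ.source) :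
    ∃ W : Set (Fin (m + k) → K), IsOpen W ∧ IsCompact W ∧ φ.toFun y₀ ∈ W ∧ W ⊆ U ∧
      W ∩ V ⊆ φ.toFun '' φ.source ∧ φ.measure ν γ W < ∞ ∧
      ∀ h : (Fin (m + k) → K) → ℂ, Continuous h →
        Tendsto (fun r => ∫ x in W, h x * deltaApprox π r (pmap f x) ∂(Measure.pi fun _ => ν)) atTop
          (𝓝 (∫ x in W, h x ∂(φ.measure ν γ))) := by
  have hVU : V ⊆ U := by rw [hV]; exact fun x hx => hx.1
  have hV0 : ∀ x ∈ V, pmap f x = 0 := by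
    rw [hV]; exact fun x hx => funext hx.2
  have hx₀ := φ.mapsTo hy₀
  have hFan := analyticAt_pmap hUo hf (hVU hx₀)
  have hφan := φ.analytic y₀ hy₀
  have hφ := hφan.hasStrictFDerivAt
  have hF := hFan.hasStrictFDerivAt
  set T := fderiv K φ.toFun y₀ with hTdef
  obtain ⟨s, hAs⟩ := exists_section (fderiv_pmap_surjective hUo hf (hVU hx₀) (hrank _ hx₀))
  have hsrc : φ.source ∈ 𝓝 y₀ := φ.isOpen_source.mem_nhds hy₀
  have hFφ : ∀ y ∈ φ.source, pmap f (φ.toFun y) = 0 := fun y hy => hV0 _ (φ.mapsTo hy)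
  have hAT : ∀ y, fderiv K (pmap f) (φ.toFun y₀) (T y) = 0 := by
    have h1 := hF.hasFDerivAt.comp y₀ hφ.hasFDerivAt
    have h2 : HasFDerivAt (pmap f ∘ φ.toFun) (0 : (Fin m → K) →L[K] (Fin k → K)) y₀ :=
      (hasFDerivAt_const (0 : Fin k → K) y₀).congr_of_eventuallyEq
        (by filter_upwards [hsrc] with y hy using hFφ y hy)
    exact fun y => DFunLike.congr_fun (h1.unique h2) y
  have hval := hγ.apply_eq hx₀ hAT hAs
  set D := volForm K (m + k)
    (Fin.append (fun i => T (Pi.single i 1)) fun j => s (Pi.single j 1)) with hD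
  have hD0 : D ≠ 0 := by
    refine volForm_append_ne_zero (T : (Fin m → K) →ₗ[K] (Fin (m + k) → K))
      (s : (Fin k → K) →ₗ[K] (Fin (m + k) → K)) fun y u h => ?_
    have h1 := congrArg (fderiv K (pmap f) (φ.toFun y₀)) h
    simp only [ContinuousLinearMap.coe_coe] at h1 h
    rw [map_add, hAT, hAs, zero_add, map_zero] at h1
    rw [h1, map_zero, add_zero] at h
    exact ⟨φ.immersion y₀ hy₀ (h.trans (map_zero _).symm), h1⟩
  -- The density is continuous with value `D ≠ 0` at `y₀`, and any value at distance less than `‖D‖`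
  -- from `D` has norm `‖D‖`.
  have hdens : ∀ᶠ y in 𝓝 y₀,
      ‖γ (φ.toFun y) fun i => fderiv K φ.toFun y (Pi.single i 1)‖ₑ = ‖D‖ₑ := by
    have hcont : ContinuousAt
        (fun y => γ (φ.toFun y) fun i => fderiv K φ.toFun y (Pi.single i 1)) y₀ := by
      refine continuousAt_form_apply (fun v => (hγ.analytic _ hx₀ v).continuousAt)
        hφan.continuousAt ?_
      refine continuousAt_pi.2 fun i => ?_
      exact hφan.fderiv.continuousAt.clm_apply continuousAt_const
    have hlt := Metric.continuousAt_iff.1 hcont ‖D‖ (norm_pos_iff.2 hD0)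
    obtain ⟨δ, hδ, hlt⟩ := hlt
    filter_upwards [Metric.ball_mem_nhds y₀ hδ] with y hy
    have h1 := hlt hy
    rw [← hTdef, hval, dist_eq_norm] at h1
    have := norm_eq_of_norm_sub_lt h1
    rw [← ofReal_norm, ← ofReal_norm, this]
  obtain ⟨ρ, hρ, W, hWo, hWc, hx₀W, hWU, hBN, hWeq, hΨc, hΨF, hmap⟩ :=
    exists_straightening hπ hnorm hν hφ hF (φ.immersion y₀ hy₀) hAT hAs
      (N := φ.source ∩ {y | ‖γ (φ.toFun y) fun i => fderiv K φ.toFun y (Pi.single i 1)‖ₑ = ‖D‖ₑ})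
      (inter_mem hsrc hdens) (fun y hy => hFφ y hy.1) (hUo.mem_nhds (hVU hx₀))
  set BX := Metric.closedBall y₀ ρ
  set BY := Metric.closedBall (0 : Fin k → K) ρ
  set μX : Measure (Fin m → K) := Measure.pi fun _ => ν
  have hBm : MeasurableSet BX := measurableSet_closedBall
  have h0Y : (0 : Fin k → K) ∈ BY := Metric.mem_closedBall_self hρ.le
  -- In the straightened coordinates `V` is exactly the slice `u = 0`, since `‖F‖ = ‖u‖`.
  have hinv : ∀ p ∈ BX ×ˢ BY, φ.toFun p.1 + s p.2 ∈ V → p.2 = 0 := by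
    intro p hp hpV
    have := hΨF p hp
    rw [hV0 _ hpV, norm_zero] at this
    exact norm_eq_zero.1 this.symm
  have hφinj : Set.InjOn φ.toFun φ.source := by
    intro a ha b hb hab
    have := φ.isOpenEmbedding.injective (a₁ := ⟨a, ha⟩) (a₂ := ⟨b, hb⟩) (Subtype.ext hab)
    exact congrArg Subtype.val this
  have hpre : φ.toFun ⁻¹' W ∩ φ.source = BX := by
    ext y
    constructor
    · rintro ⟨hyW, hys⟩
      rw [Set.mem_preimage, hWeq] at hyW
      obtain ⟨p, hp, hpy⟩ := hyW
      have hp2 := hinv p hp (by beta_reduce at hpy; rw [hpy]; exact φ.mapsTo hys)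
      beta_reduce at hpy
      rw [hp2, map_zero, add_zero] at hpy
      rw [← hφinj (hBN hp.1).1 hys hpy]
      exact hp.1
    · intro hy
      refine ⟨?_, (hBN hy).1⟩
      rw [Set.mem_preimage, hWeq]
      exact ⟨(y, 0), ⟨hy, h0Y⟩, by simp⟩
  have hsm : MeasurableSet φ.source := φ.isOpen_source.measurableSet
  have hφcont : ContinuousOn φ.toFun φ.source := φ.analytic.continuousOn
  have hφae : AEMeasurable φ.toFun (μX.restrict φ.source) := hφcont.aemeasurable hsm
  have hφB : AEMeasurable φ.toFun (μX.restrict BX) :=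
    hφae.mono_measure (Measure.restrict_mono (fun y hy => (hBN hy).1) le_rfl)
  have hmeas : (φ.measure ν γ).restrict W = ‖D‖ₑ • Measure.map φ.toFun (μX.restrict BX) := by
    unfold Parametrization.measure
    rw [Measure.restrict_map_of_aemeasurable
      (hφae.mono_ac (withDensity_absolutelyContinuous _ _)) hWc.measurableSet,
      restrict_withDensity', Measure.restrict_restrict' hsm, hpre, ← Measure.map_smul,
      ← withDensity_const]
    congr 1
    refine withDensity_congr_ae (ae_restrict_of_forall_mem hBm fun y hy => (hBN hy).2)
  have hDe : ‖D‖ₑ ≠ ∞ := enorm_ne_top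
  refine ⟨W, hWo, hWc, hx₀W, hWU, ?_, ?_, fun h hh => ?_⟩
  · rintro x ⟨hxW, hxV⟩
    rw [hWeq] at hxW
    obtain ⟨p, hp, rfl⟩ := hxW
    refine ⟨p.1, (hBN hp.1).1, ?_⟩
    beta_reduce
    rw [hinv p hp hxV, map_zero, add_zero]
  · have : φ.measure ν γ W = (φ.measure ν γ).restrict W Set.univ := by simp
    rw [this, hmeas, Measure.smul_apply, smul_eq_mul,
      Measure.map_apply_of_aemeasurable hφB MeasurableSet.univ]
    refine ENNReal.mul_lt_top hDe.lt_top ?_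
    simpa using (isCompact_closedBall y₀ ρ).measure_lt_top
  · rw [hmeas, integral_smul_measure, integral_map hφB hh.aestronglyMeasurable]
    have hΨae : AEMeasurable (fun p : (Fin m → K) × (Fin k → K) => φ.toFun p.1 + s p.2)
        ((μX.restrict BX).prod ((Measure.pi fun _ => ν).restrict BY)) := by
      rw [Measure.prod_restrict]
      exact hΨc.aemeasurable (hBm.prod measurableSet_closedBall)
    have hr : ∀ r, ∫ x in W, h x * deltaApprox π r (pmap f x) ∂(Measure.pi fun _ => ν) =
        ‖D‖ₑ.toReal • ∫ p, h (φ.toFun p.1 + s p.2) * deltaApprox π r p.2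
          ∂((μX.restrict BX).prod ((Measure.pi fun _ => ν).restrict BY)) := by
      intro r
      have hsm : AEStronglyMeasurable (fun x => h x * deltaApprox π r (pmap f x))
          ((Measure.pi fun _ => ν).restrict W) := by
        refine ContinuousOn.aestronglyMeasurable ?_ hWc.measurableSet
        refine hh.continuousOn.mul ((continuous_deltaApprox hπ r).comp_continuousOn fun x hx => ?_)
        exact (analyticAt_pmap hUo hf (hWU hx)).continuousAt.continuousWithinAt
      rw [← hmap] at hsm ⊢
      -- As `D ≠ 0`, scaling by `‖D‖ₑ` creates no null sets, so measurability passes to the unscaled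
      -- image measure.
      have hsm' := hsm.mono_ac (Measure.absolutelyContinuous_smul (enorm_ne_zero.2 hD0))
      rw [integral_smul_measure, integral_map hΨae hsm']
      congr 1
      refine integral_congr_ae ?_
      rw [Measure.prod_restrict]
      refine ae_restrict_of_forall_mem (hBm.prod measurableSet_closedBall) fun p hp => ?_
      beta_reduce
      rw [deltaApprox_congr_norm hπ r (hΨF p hp)]
    simp_rw [hr]
    refine Tendsto.const_smul ?_ _
    have hG : ContinuousOn (fun p : (Fin m → K) × (Fin k → K) => h (φ.toFun p.1 + s p.2))
        (BX ×ˢ BY) := hh.comp_continuousOn hΨc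
    simpa using tendsto_integral_prod_deltaApprox hπ hnorm hν hρ hG

end LocalLimit

/-! ### Existence of parametrizations. -/

section Charts

variable {K : Type*} [NontriviallyNormedField K] [IsUltrametricDist K] [ProperSpace K] {m k : ℕ}
  {U V : Set (Fin (m + k) → K)} {f : Fin k → MvPowerSeries (Fin (m + k)) K}

/-- Project to the kernel along a section of `A` and identify the kernel with `K ^ m`. The result
completes `F` to a local coordinate system. -/
theorem exists_adapted_equiv {A : (Fin (m + k) → K) →L[K] (Fin k → K)}
    (hA : Function.Surjective A) :
    ∃ P : (Fin (m + k) → K) ≃L[K] (Fin m → K) × (Fin k → K), ∀ x, (P x).2 = A x := by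
  let A' : (Fin (m + k) → K) →ₗ[K] (Fin k → K) := A
  have hrange : LinearMap.range A' = ⊤ := LinearMap.range_eq_top.2 hA
  obtain ⟨s, hs⟩ := LinearMap.exists_rightInverse_of_surjective A' hrange
  have hs' : ∀ u, A' (s u) = u := fun u => LinearMap.congr_fun hs u
  have hker : Module.finrank K (LinearMap.ker A') = Module.finrank K (Fin m → K) := by
    have := LinearMap.finrank_range_add_finrank_ker A'
    rw [hrange] at this
    simp only [finrank_top, Module.finrank_fin_fun] at this ⊢
    omega
  let e : LinearMap.ker A' ≃ₗ[K] (Fin m → K) := LinearEquiv.ofFinrankEq _ _ hker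
  let c : (Fin (m + k) → K) →ₗ[K] LinearMap.ker A' :=
    LinearMap.codRestrict (LinearMap.ker A') (LinearMap.id - s.comp A') fun x => by
      simp [hs']
  let P₀ : (Fin (m + k) → K) →ₗ[K] (Fin m → K) × (Fin k → K) := (e.toLinearMap.comp c).prod A'
  have hinj : Function.Injective P₀ := by
    rw [← LinearMap.ker_eq_bot, LinearMap.ker_eq_bot']
    intro x hx
    have h2 : A' x = 0 := congrArg Prod.snd hx
    have h1 : e (c x) = 0 := congrArg Prod.fst hx
    have h3 : c x = 0 := e.map_eq_zero_iff.1 h1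
    have h4 : x - s (A' x) = 0 := congrArg Subtype.val h3
    rwa [h2, map_zero, sub_zero] at h4
  exact ⟨(P₀.linearEquivOfInjective hinj (by simp)).toContinuousLinearEquiv, fun x => rfl⟩

/-- The analytic implicit function theorem for a zero locus of power series. -/
theorem exists_parametrization (hUo : IsOpen U) (hf : ∀ i, ConvergesOn (f i) U)
    (hV : V = zeroLocus f U) (hrank : ∀ x ∈ V, (jacobian f x).rank = k)
    {x₀ : Fin (m + k) → K} (hx₀ : x₀ ∈ V) :
    ∃ φ : Parametrization V m, x₀ ∈ φ.toFun '' φ.source := by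
  have hVU : V ⊆ U := by rw [hV]; exact fun x hx => hx.1
  have hV0 : ∀ x ∈ V, pmap f x = 0 := by
    rw [hV]; exact fun x hx => funext hx.2
  have hFan := analyticAt_pmap hUo hf (hVU hx₀)
  obtain ⟨P, hP⟩ := exists_adapted_equiv
    (fderiv_pmap_surjective hUo hf (hVU hx₀) (hrank _ hx₀))
  let pr : (Fin (m + k) → K) →L[K] (Fin m → K) :=
    (ContinuousLinearMap.fst K (Fin m → K) (Fin k → K)).comp
      (P : (Fin (m + k) → K) →L[K] (Fin m → K) × (Fin k → K))
  let G : (Fin (m + k) → K) → (Fin m → K) × (Fin k → K) := fun x => (pr x, pmap f x)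
  have hGan : AnalyticAt K G x₀ := (pr.analyticAt x₀).prod hFan
  have hG : HasStrictFDerivAt G (P : (Fin (m + k) → K) →L[K] (Fin m → K) × (Fin k → K)) x₀ := by
    refine (pr.hasStrictFDerivAt.prodMk hFan.hasStrictFDerivAt).congr_fderiv ?_
    ext1 x
    exact Prod.ext rfl (hP x).symm
  let Q := hG.toOpenPartialHomeomorph G
  have hQ : ∀ x, Q x = G x := fun x => rfl
  have hx₀Q : x₀ ∈ Q.source := hG.mem_toOpenPartialHomeomorph_source
  -- The power series of `G` at `x₀` has invertible linear part `P`, so the local inverse is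
  -- analytic and not merely differentiable.
  have hsymm : AnalyticAt K Q.symm (G x₀) := by
    obtain ⟨p, hp⟩ := hGan
    have hp1 : p 1 = (continuousMultilinearCurryFin1 K (Fin (m + k) → K)
        ((Fin m → K) × (Fin k → K))).symm
        (P : (Fin (m + k) → K) →L[K] (Fin m → K) × (Fin k → K)) := by
      rw [LinearIsometryEquiv.eq_symm_apply]
      exact hp.hasFDerivAt.unique hG.hasFDerivAt
    exact (Q.hasFPowerSeriesAt_symm hx₀Q hp hp1).analyticAt
  have hQx₀ : Q.symm (G x₀) = x₀ := Q.left_inv hx₀Q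
  have hev : ∀ᶠ p in 𝓝 (G x₀), p ∈ Q.target ∧ AnalyticAt K Q.symm p ∧ Q.symm p ∈ U :=
    Filter.inter_mem (Q.open_target.mem_nhds (Q.map_source hx₀Q))
      (Filter.inter_mem hsymm.eventually_analyticAt
        (hsymm.continuousAt.preimage_mem_nhds (by rw [hQx₀]; exact hUo.mem_nhds (hVU hx₀))))
  obtain ⟨O, hO, hOo, hx₀O⟩ := eventually_nhds_iff.1 hev
  let src : Set (Fin m → K) := {y | (y, (0 : Fin k → K)) ∈ O}
  let φ : (Fin m → K) → (Fin (m + k) → K) := fun y => Q.symm (y, 0)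
  have hGφ : ∀ y ∈ src, G (φ y) = (y, 0) := fun y hy => Q.right_inv (hO _ hy).1
  have hprφ : ∀ y ∈ src, pr (φ y) = y := fun y hy => congrArg Prod.fst (hGφ y hy)
  have hsrc : IsOpen src := hOo.preimage (by fun_prop)
  have han : AnalyticOnNhd K φ src := fun y hy =>
    AnalyticAt.comp (g := Q.symm) (f := fun y : Fin m → K => (y, (0 : Fin k → K))) (hO _ hy).2.1
      ((ContinuousLinearMap.inl K (Fin m → K) (Fin k → K)).analyticAt y)
  have hmaps : Set.MapsTo φ src V := by
    intro y hy
    rw [hV]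
    exact ⟨(hO _ hy).2.2, fun i => congrFun (congrArg Prod.snd (hGφ y hy)) i⟩
  refine ⟨⟨src, φ, hsrc, han, ?_, hmaps, ?_⟩, ?_⟩
  · intro y hy
    have h1 : HasFDerivAt (fun y => pr (φ y)) (pr.comp (fderiv K φ y)) y :=
      pr.hasFDerivAt.comp y (han y hy).differentiableAt.hasFDerivAt
    have h2 : HasFDerivAt (fun y => pr (φ y)) (ContinuousLinearMap.id K _) y :=
      (hasFDerivAt_id y).congr_of_eventuallyEq
        (by filter_upwards [hsrc.mem_nhds hy] with z hz using hprφ z hz)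
    have h3 := h1.unique h2
    -- The projection `pr` is a left inverse of `φ`. Differentiated, this gives the immersion;
    -- undifferentiated, the embedding below.
    exact Function.LeftInverse.injective (g := pr) fun v => DFunLike.congr_fun h3 v
  · refine ⟨?_, ?_⟩
    · refine IsEmbedding.of_comp (g := fun v : V => pr v) ?_ (by fun_prop) ?_
      · exact (continuousOn_iff_continuous_domRestrict.1 han.continuousOn).subtype_mk _
      · have : ((fun v : V => pr v) ∘ fun y : src => (⟨φ y, hmaps y.2⟩ : V)) = Subtype.val :=
          funext fun y => hprφ y y.2
        rw [this]
        exact IsEmbedding.subtypeVal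
    · have hopen := (Q.continuousOn.isOpen_inter_preimage Q.open_source hOo).preimage
        (continuous_subtype_val (p := (· ∈ V)))
      convert! hopen using 1
      ext v
      constructor
      · rintro ⟨y, rfl⟩
        refine ⟨Q.map_target (hO _ y.2).1, ?_⟩
        change G (φ y) ∈ O
        rw [hGφ y y.2]
        exact y.2
      · rintro ⟨hv1, hv2⟩
        have hGv : G v = (pr v, 0) := by
          simp only [G, hV0 v v.2]
        have hv2' : G v ∈ O := hv2
        have hQv : Q.symm (G v) = v := Q.left_inv hv1
        rw [hGv] at hv2' hQv
        exact ⟨⟨pr v, hv2'⟩, Subtype.ext hQv⟩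
  · have hGx₀ : G x₀ = (pr x₀, 0) := by
      simp only [G, hV0 x₀ hx₀]
    rw [hGx₀] at hx₀O hQx₀
    exact ⟨pr x₀, hx₀O, hQx₀⟩

end Charts

/-! ### The measures of single parametrizations glue. -/

section Gluing

variable {K : Type*} [NontriviallyNormedField K] [IsUltrametricDist K] [ProperSpace K] {π : RK K}
  [MeasurableSpace K] [BorelSpace K] {ν : Measure K} [ν.IsAddHaarMeasure] {m k : ℕ}
  {U V : Set (Fin (m + k) → K)} {f : Fin k → MvPowerSeries (Fin (m + k)) K}
  {γ : (Fin (m + k) → K) → (Fin (m + k) → K) [⋀^Fin m]→ₗ[K] K}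

/-- On `W` the measures `δ_r (f (x)) |dx|` converge to `η`, tested against continuous functions. -/
def HasDeltaLimit (π : RK K) (ν : Measure K) (f : Fin k → MvPowerSeries (Fin (m + k)) K)
    (η : Measure (Fin (m + k) → K)) (W : Set (Fin (m + k) → K)) : Prop :=
  ∀ h : (Fin (m + k) → K) → ℂ, Continuous h →
    Tendsto (fun r => ∫ x in W, h x * deltaApprox π r (pmap f x) ∂(Measure.pi fun _ => ν)) atTop
      (𝓝 (∫ x in W, h x ∂η))

/-- Cutting a continuous test function off at a clopen set leaves it continuous. -/
theorem HasDeltaLimit.mono {η : Measure (Fin (m + k) → K)} {W C : Set (Fin (m + k) → K)}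
    (hW : HasDeltaLimit π ν f η W) (hC : IsClopen C) (hCW : C ⊆ W) :
    HasDeltaLimit π ν f η C := by
  intro h hh
  have hCm : MeasurableSet C := hC.isClosed.measurableSet
  have hc : Continuous (C.indicator h) :=
    hh.indicator fun a ha => by rw [hC.frontier_eq] at ha; exact ha.elim
  have := hW (C.indicator h) hc
  rw [setIntegral_indicator hCm, Set.inter_eq_right.2 hCW] at this
  refine this.congr fun r => ?_
  have : (fun x => C.indicator h x * deltaApprox π r (pmap f x)) =
      C.indicator fun x => h x * deltaApprox π r (pmap f x) := by
    funext x
    by_cases hx : x ∈ C <;> simp [hx]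
  rw [this, setIntegral_indicator hCm, Set.inter_eq_right.2 hCW]

theorem HasDeltaLimit.congr {η η' : Measure (Fin (m + k) → K)} {W : Set (Fin (m + k) → K)}
    (hW : HasDeltaLimit π ν f η W) (hη : η.restrict W = η'.restrict W) :
    HasDeltaLimit π ν f η' W := by
  intro h hh
  rw [← hη]
  exact hW h hh

theorem HasDeltaLimit.restrict_eq {η η' : Measure (Fin (m + k) → K)} {W : Set (Fin (m + k) → K)}
    (hW : HasDeltaLimit π ν f η W) (hW' : HasDeltaLimit π ν f η' W) (hfin : η W < ∞)
    (hfin' : η' W < ∞) : η.restrict W = η'.restrict W := by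
  have : IsFiniteMeasure (η.restrict W) := ⟨by simpa using hfin⟩
  have : IsFiniteMeasure (η'.restrict W) := ⟨by simpa using hfin'⟩
  refine ext_of_forall_integral_eq_of_IsFiniteMeasure fun h => ?_
  have hc : Continuous fun x => ((h x : ℝ) : ℂ) := by fun_prop
  have := tendsto_nhds_unique (hW _ hc) (hW' _ hc)
  rw [integral_complex_ofReal, integral_complex_ofReal] at this
  exact Complex.ofReal_injective this

theorem Parametrization.aemeasurable (φ : Parametrization V m) :
    AEMeasurable φ.toFun ((Measure.pi fun _ : Fin m => ν).restrict φ.source) :=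
  φ.analytic.continuousOn.aemeasurable φ.isOpen_source.measurableSet

theorem Parametrization.measure_eq_zero (φ : Parametrization V m) {s : Set (Fin (m + k) → K)}
    (hs : MeasurableSet s) (hdisj : Disjoint s (φ.toFun '' φ.source)) : φ.measure ν γ s = 0 := by
  unfold Parametrization.measure
  rw [Measure.map_apply_of_aemeasurable
    (φ.aemeasurable.mono_ac (withDensity_absolutelyContinuous _ _)) hs]
  refine withDensity_absolutelyContinuous _ _ ?_
  rw [Measure.restrict_apply' φ.isOpen_source.measurableSet]
  have : φ.toFun ⁻¹' s ∩ φ.source = ∅ := by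
    rw [Set.eq_empty_iff_forall_notMem]
    exact fun y hy => Set.disjoint_left.1 hdisj hy.1 ⟨y, hy.2, rfl⟩
  rw [this, measure_empty]

/-- Both measures are limits of the same chart-free measures `δ_r(F) |dx|`, and finite measures are
determined by integrals of continuous functions. -/
theorem Parametrization.exists_restrict_eq (hπ : Irreducible π) (hnorm : ‖(π : K)‖ = (q K : ℝ)⁻¹)
    (hν : ν (RK K : Set K) = 1) (hUo : IsOpen U) (hf : ∀ i, ConvergesOn (f i) U)
    (hV : V = zeroLocus f U) (hrank : ∀ x ∈ V, (jacobian f x).rank = k)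
    (hγ : IsGelfandLeray f V γ) (φ ψ : Parametrization V m) {x : Fin (m + k) → K}
    (hφ : x ∈ φ.toFun '' φ.source) (hψ : x ∈ ψ.toFun '' ψ.source) :
    ∃ N ∈ 𝓝 x, (φ.measure ν γ).restrict N = (ψ.measure ν γ).restrict N := by
  obtain ⟨y, hy, rfl⟩ := hφ
  obtain ⟨z, hz, hzy⟩ := hψ
  obtain ⟨W, hWo, hWc, hxW, -, -, hfin, hlim⟩ :=
    φ.exists_local_limit hπ hnorm hν hUo hf hV hrank hγ hy
  obtain ⟨W', hWo', hWc', hxW', -, -, hfin', hlim'⟩ :=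
    ψ.exists_local_limit hπ hnorm hν hUo hf hV hrank hγ hz
  rw [hzy] at hxW'
  have hclopen : IsClopen (W ∩ W') := ⟨hWc.isClosed.inter hWc'.isClosed, hWo.inter hWo'⟩
  refine ⟨W ∩ W', inter_mem (hWo.mem_nhds hxW) (hWo'.mem_nhds hxW'), ?_⟩
  exact HasDeltaLimit.restrict_eq (π := π) (ν := ν) (f := f)
    (HasDeltaLimit.mono hlim hclopen Set.inter_subset_left)
    (HasDeltaLimit.mono hlim' hclopen Set.inter_subset_right)
    ((measure_mono Set.inter_subset_left).trans_lt hfin)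
    ((measure_mono Set.inter_subset_right).trans_lt hfin')

/-- When one chart covers `W ∩ V`, no other chart can add mass on `W`: on the overlap they agree
locally, and off its own image a chart measure vanishes. -/
theorem formMeasure_restrict (hπ : Irreducible π) (hnorm : ‖(π : K)‖ = (q K : ℝ)⁻¹)
    (hν : ν (RK K : Set K) = 1) (hUo : IsOpen U) (hf : ∀ i, ConvergesOn (f i) U)
    (hV : V = zeroLocus f U) (hrank : ∀ x ∈ V, (jacobian f x).rank = k)
    (hγ : IsGelfandLeray f V γ) (φ : Parametrization V m) {W : Set (Fin (m + k) → K)}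
    (hW : MeasurableSet W) (hWφ : W ∩ V ⊆ φ.toFun '' φ.source) :
    (formMeasure ν V γ).restrict W = (φ.measure ν γ).restrict W := by
  have hle : ∀ ψ : Parametrization V m,
      (ψ.measure ν γ).restrict W ≤ (φ.measure ν γ).restrict W := by
    intro ψ
    have hN : ∀ x ∈ W ∩ ψ.toFun '' ψ.source, ∃ N, IsOpen N ∧ x ∈ N ∧
        (ψ.measure ν γ).restrict N = (φ.measure ν γ).restrict N := by
      rintro x ⟨hxW, y, hy, rfl⟩
      obtain ⟨N, hN, h⟩ := ψ.exists_restrict_eq hπ hnorm hν hUo hf hV hrank hγ φ ⟨y, hy, rfl⟩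
        (hWφ ⟨hxW, ψ.mapsTo hy⟩)
      obtain ⟨N', hN'N, hN'o, hxN'⟩ := mem_nhds_iff.1 hN
      refine ⟨N', hN'o, hxN', ?_⟩
      have := congrArg (fun η : Measure _ => η.restrict N') h
      simpa only [Measure.restrict_restrict hN'o.measurableSet, Set.inter_eq_left.2 hN'N] using this
    choose! N hNo hxN hNeq using hN
    -- Agreement is known only near each point; second countability reduces to countably many
    -- neighbourhoods.
    obtain ⟨t, hts, htc, hcov⟩ := TopologicalSpace.countable_cover_nhdsWithin
      (f := N) (s := W ∩ ψ.toFun '' ψ.source)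
      fun x hx => mem_nhdsWithin_of_mem_nhds ((hNo x hx).mem_nhds (hxN x hx))
    have hOeq : (ψ.measure ν γ).restrict (⋃ x ∈ t, N x) =
        (φ.measure ν γ).restrict (⋃ x ∈ t, N x) :=
      (Measure.restrict_biUnion_congr htc).2 fun x hx => hNeq x (hts hx)
    have hOm : MeasurableSet (⋃ x ∈ t, N x) :=
      (isOpen_biUnion fun x hx => hNo x (hts hx)).measurableSet
    refine Measure.le_iff.2 fun s hs => ?_
    rw [Measure.restrict_apply hs, Measure.restrict_apply hs]
    have h0 : ψ.measure ν γ ((s ∩ W) \ ⋃ x ∈ t, N x) = 0 := by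
      refine ψ.measure_eq_zero ((hs.inter hW).diff hOm) (Set.disjoint_left.2 ?_)
      rintro x ⟨⟨-, hxW⟩, hxO⟩ hxψ
      exact hxO (hcov ⟨hxW, hxψ⟩)
    have h1 : ψ.measure ν γ (s ∩ W ∩ ⋃ x ∈ t, N x) = φ.measure ν γ (s ∩ W ∩ ⋃ x ∈ t, N x) := by
      rw [← Measure.restrict_apply (hs.inter hW), hOeq, Measure.restrict_apply (hs.inter hW)]
    rw [← measure_inter_add_sdiff (s ∩ W) hOm, h0, add_zero, h1]
    exact measure_mono Set.inter_subset_left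
  refine le_antisymm ?_ (Measure.restrict_mono le_rfl (le_iSup (fun φ => φ.measure ν γ) φ))
  -- A supremum of measures is not a supremum set by set. The bound comes from a single measure
  -- dominating every chart measure, whose second summand disappears on restriction to `W`.
  have hsum : formMeasure ν V γ ≤
      (φ.measure ν γ).restrict W + (formMeasure ν V γ).restrict Wᶜ := by
    refine iSup_le fun ψ => ?_
    rw [← Measure.restrict_add_restrict_compl (μ := ψ.measure ν γ) hW]
    exact add_le_add (hle ψ)
      (Measure.restrict_mono le_rfl (le_iSup (fun φ : Parametrization V m => φ.measure ν γ) ψ))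
  refine (Measure.restrict_mono (le_refl W) hsum).trans ?_
  rw [Measure.restrict_add, Measure.restrict_restrict hW, Measure.restrict_restrict hW,
    Set.inter_self, Set.inter_compl_self, Measure.restrict_empty, add_zero]

theorem formMeasure_compl (hVm : MeasurableSet V) : formMeasure ν V γ Vᶜ = 0 := by
  have hle : formMeasure ν V γ ≤ (formMeasure ν V γ).restrict V := by
    refine iSup_le fun ψ => ?_
    have h0 : ψ.measure ν γ Vᶜ = 0 := by
      refine ψ.measure_eq_zero hVm.compl (Set.disjoint_left.2 ?_)
      rintro _ hx ⟨y, hy, rfl⟩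
      exact hx (ψ.mapsTo hy)
    rw [← Measure.restrict_add_restrict_compl (μ := ψ.measure ν γ) hVm,
      Measure.restrict_eq_zero.2 h0, add_zero]
    exact Measure.restrict_mono le_rfl (le_iSup (fun φ : Parametrization V m => φ.measure ν γ) ψ)
  refine le_antisymm ((hle _).trans ?_) zero_le
  rw [Measure.restrict_apply hVm.compl]
  simp

end Gluing

/-! ### From local limits to compact sets. -/

section Globalization

variable {K : Type*} [NontriviallyNormedField K] [IsUltrametricDist K] [ProperSpace K] {π : RK K}
  [MeasurableSpace K] [BorelSpace K] {ν : Measure K} [ν.IsAddHaarMeasure] {m k : ℕ}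
  {U V : Set (Fin (m + k) → K)} {f : Fin k → MvPowerSeries (Fin (m + k)) K}
  {γ : (Fin (m + k) → K) → (Fin (m + k) → K) [⋀^Fin m]→ₗ[K] K}

theorem integrableOn_mul_deltaApprox (hπ : Irreducible π) (hUo : IsOpen U)
    (hf : ∀ i, ConvergesOn (f i) U) {W : Set (Fin (m + k) → K)} (hWc : IsCompact W) (hWU : W ⊆ U)
    {h : (Fin (m + k) → K) → ℂ} (hh : Continuous h) (r : ℕ) :
    IntegrableOn (fun x => h x * deltaApprox π r (pmap f x)) W (Measure.pi fun _ => ν) := by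
  refine ContinuousOn.integrableOn_compact hWc (hh.continuousOn.mul
    ((continuous_deltaApprox hπ r).comp_continuousOn fun x hx => ?_))
  exact (analyticAt_pmap hUo hf (hWU hx)).continuousAt.continuousWithinAt

theorem integrableOn_of_continuous {η : Measure (Fin (m + k) → K)} {W : Set (Fin (m + k) → K)}
    (hWc : IsCompact W) (hfin : η W < ∞) {h : (Fin (m + k) → K) → ℂ} (hh : Continuous h) :
    IntegrableOn h W η := by
  obtain ⟨C, hC⟩ := hWc.exists_bound_of_continuousOn hh.continuousOn
  exact Measure.integrableOn_of_bounded hfin.ne hh.aestronglyMeasurable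
    (ae_restrict_of_forall_mem hWc.measurableSet hC)

theorem isClosed_zeroLocus (hUo : IsOpen U) (hUc : IsCompact U) (hf : ∀ i, ConvergesOn (f i) U) :
    IsClosed (zeroLocus f U) := by
  have hcont : ContinuousOn (pmap f) U := fun x hx =>
    (analyticAt_pmap hUo hf hx).continuousAt.continuousWithinAt
  have := hcont.preimage_isClosed_of_isClosed hUc.isClosed (isClosed_singleton (x := 0))
  convert! this using 1
  ext x
  simp [zeroLocus, pmap, funext_iff]

/-- Every point of `U` has a compact open neighbourhood on which the limit formula holds. -/
theorem exists_nhds_hasDeltaLimit (hπ : Irreducible π) (hnorm : ‖(π : K)‖ = (q K : ℝ)⁻¹)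
    (hν : ν (RK K : Set K) = 1) (hUo : IsOpen U) (hUc : IsCompact U)
    (hf : ∀ i, ConvergesOn (f i) U)
    (hV : V = zeroLocus f U) (hrank : ∀ x ∈ V, (jacobian f x).rank = k)
    (hγ : IsGelfandLeray f V γ) {x : Fin (m + k) → K} (hx : x ∈ U) :
    ∃ W, x ∈ W ∧ IsOpen W ∧ IsCompact W ∧ W ⊆ U ∧ formMeasure ν V γ W < ∞ ∧
      HasDeltaLimit π ν f (formMeasure ν V γ) W := by
  by_cases hxV : x ∈ V
  · obtain ⟨φ, y, hy, rfl⟩ := exists_parametrization hUo hf hV hrank hxV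
    obtain ⟨W, hWo, hWc, hxW, hWU, hWφ, hfin, hlim⟩ :=
      φ.exists_local_limit hπ hnorm hν hUo hf hV hrank hγ hy
    have heq := formMeasure_restrict hπ hnorm hν hUo hf hV hrank hγ φ hWc.measurableSet hWφ
    refine ⟨W, hxW, hWo, hWc, hWU, ?_, HasDeltaLimit.congr hlim heq.symm⟩
    rw [← Measure.restrict_apply_self, heq, Measure.restrict_apply_self]
    exact hfin
  · have hF0 : pmap f x ≠ 0 := by
      intro h0
      refine hxV ?_
      rw [hV]
      exact ⟨hx, fun i => congrFun h0 i⟩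
    have hε : 0 < ‖pmap f x‖ / 2 := half_pos (norm_pos_iff.2 hF0)
    have hev : ∀ᶠ z in 𝓝 x, ‖pmap f x‖ / 2 < ‖pmap f z‖ :=
      (analyticAt_pmap hUo hf hx).continuousAt.norm.eventually
        (lt_mem_nhds (half_lt_self (norm_pos_iff.2 hF0)))
    obtain ⟨ρ, hρ, hball⟩ := Metric.nhds_basis_closedBall.mem_iff.1
      (inter_mem (hUo.mem_nhds hx) hev)
    have hzero : formMeasure ν V γ (Metric.closedBall x ρ) = 0 := by
      have hVm : MeasurableSet V := by
        rw [hV]; exact (isClosed_zeroLocus hUo hUc hf).measurableSet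
      have hsub : Metric.closedBall x ρ ⊆ Vᶜ := by
        intro z hz hzV
        have h1 : ‖pmap f x‖ / 2 < ‖pmap f z‖ := (hball hz).2
        rw [hV] at hzV
        rw [show pmap f z = 0 from funext hzV.2, norm_zero] at h1
        exact h1.not_gt hε
      exact measure_mono_null hsub (formMeasure_compl hVm)
    refine ⟨Metric.closedBall x ρ, Metric.mem_closedBall_self hρ.le,
      IsUltrametricDist.isOpen_closedBall x hρ.ne', isCompact_closedBall x ρ,
      fun z hz => (hball hz).1, by rw [hzero]; exact ENNReal.zero_lt_top, fun h hh => ?_⟩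
    rw [setIntegral_measure_zero _ hzero]
    -- Off `V` the norm of `F` is locally bounded below, so `δ_r(F)` vanishes on the whole ball for
    -- large `r`.
    obtain ⟨R, hR⟩ : ∃ R : ℕ, ‖(π : K)‖ ^ R < ‖pmap f x‖ / 2 :=
      exists_pow_lt_of_lt_one hε (norm_uniformizer_lt_one hπ)
    refine tendsto_const_nhds.congr' ?_
    filter_upwards [eventually_ge_atTop R] with r hr
    refine (setIntegral_eq_zero_of_forall_eq_zero fun z hz => ?_).symm
    rw [deltaApprox_eq hπ, Set.indicator_of_notMem, mul_zero]
    rw [mem_closedBall_zero_iff, not_le]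
    exact ((pow_le_pow_of_le_one (norm_nonneg _) (norm_uniformizer_lt_one hπ).le hr).trans_lt
      hR).trans (hball hz).2

/-- Compact open sets are clopen, so `W'` may be replaced by `W' \ W` and the integrals add. -/
theorem HasDeltaLimit.union (hπ : Irreducible π) (hUo : IsOpen U)
    (hf : ∀ i, ConvergesOn (f i) U) {η : Measure (Fin (m + k) → K)}
    {W W' : Set (Fin (m + k) → K)} (hWo : IsOpen W) (hWc : IsCompact W) (hWU : W ⊆ U)
    (hWo' : IsOpen W') (hWc' : IsCompact W') (hWU' : W' ⊆ U) (hfin : η W < ∞) (hfin' : η W' < ∞)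
    (hW : HasDeltaLimit π ν f η W) (hW' : HasDeltaLimit π ν f η W') :
    HasDeltaLimit π ν f η (W ∪ W') := by
  have hclopen : IsClopen (W' \ W) := IsClopen.diff ⟨hWc'.isClosed, hWo'⟩ ⟨hWc.isClosed, hWo⟩
  have hC := hW'.mono hclopen Set.sdiff_subset
  have hCc : IsCompact (W' \ W) := hWc'.diff hWo
  have hCm : MeasurableSet (W' \ W) := hCc.measurableSet
  intro h hh
  rw [← Set.union_sdiff_self]
  rw [setIntegral_union Set.disjoint_sdiff_right hCm (integrableOn_of_continuous hWc hfin hh)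
    (integrableOn_of_continuous hCc ((measure_mono Set.sdiff_subset).trans_lt hfin') hh)]
  refine ((hW h hh).add (hC h hh)).congr fun r => ?_
  rw [setIntegral_union Set.disjoint_sdiff_right hCm
    (integrableOn_mul_deltaApprox hπ hUo hf hWc hWU hh r)
    (integrableOn_mul_deltaApprox hπ hUo hf hCc (Set.sdiff_subset.trans hWU') hh r)]

theorem exists_hasDeltaLimit_of_isCompact (hπ : Irreducible π) (hnorm : ‖(π : K)‖ = (q K : ℝ)⁻¹)
    (hν : ν (RK K : Set K) = 1) (hUo : IsOpen U) (hUc : IsCompact U)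
    (hf : ∀ i, ConvergesOn (f i) U)
    (hV : V = zeroLocus f U) (hrank : ∀ x ∈ V, (jacobian f x).rank = k)
    (hγ : IsGelfandLeray f V γ) {S : Set (Fin (m + k) → K)} (hS : IsCompact S) (hSU : S ⊆ U) :
    ∃ W, S ⊆ W ∧ IsOpen W ∧ IsCompact W ∧ W ⊆ U ∧ formMeasure ν V γ W < ∞ ∧
      HasDeltaLimit π ν f (formMeasure ν V γ) W := by
  refine hS.induction_on (p := fun S => ∃ W, S ⊆ W ∧ IsOpen W ∧ IsCompact W ∧ W ⊆ U ∧
    formMeasure ν V γ W < ∞ ∧ HasDeltaLimit π ν f (formMeasure ν V γ) W) ?_ ?_ ?_ ?_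
  · exact ⟨∅, subset_rfl, isOpen_empty, isCompact_empty, Set.empty_subset _, by simp,
      fun h _ => by simp⟩
  · rintro s t hst ⟨W, htW, hW⟩
    exact ⟨W, hst.trans htW, hW⟩
  · rintro s t ⟨W, hsW, hWo, hWc, hWU, hfin, hlim⟩ ⟨W', htW', hWo', hWc', hWU', hfin', hlim'⟩
    exact ⟨W ∪ W', Set.union_subset_union hsW htW', hWo.union hWo', hWc.union hWc',
      Set.union_subset hWU hWU', measure_union_lt_top hfin hfin',
      hlim.union hπ hUo hf hWo hWc hWU hWo' hWc' hWU' hfin hfin' hlim'⟩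
  · intro x hx
    obtain ⟨W, hxW, hWo, hW⟩ :=
      exists_nhds_hasDeltaLimit hπ hnorm hν hUo hUc hf hV hrank hγ (hSU hx)
    exact ⟨W, mem_nhdsWithin_of_mem_nhds (hWo.mem_nhds hxW), W, subset_rfl, hWo, hW⟩

/-- Outside `U` nothing is known about the sum of `g`, but there the locally constant `Φ` vanishes
in a neighbourhood. -/
theorem continuous_mul_quasiVal_psum (hπ : Irreducible π) (hnorm : ‖(π : K)‖ = (q K : ℝ)⁻¹)
    (hUo : IsOpen U) {g : MvPowerSeries (Fin (m + k)) K} (hg : ConvergesOn g U)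
    {Φ : (Fin (m + k) → K) → ℂ} (hΦ : IsLocallyConstant Φ) (hΦU : Function.support Φ ⊆ U)
    {ω : Kˣ →ₜ* ℂˣ} (hω : ω ∈ Omega π 0) :
    Continuous fun x => Φ x * quasiVal ω (psum g x) := by
  rw [continuous_iff_continuousAt]
  intro x
  by_cases hx : x ∈ U
  · exact hΦ.continuous.continuousAt.mul
      (ContinuousAt.comp (g := quasiVal ω) (continuous_quasiVal hπ hnorm hω).continuousAt
        (hg.analyticAt hUo hx).continuousAt)
  · have h0 : Φ x = 0 := by
      by_contra h
      exact hx (hΦU h)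
    refine (continuousAt_const (y := (0 : ℂ))).congr ?_
    filter_upwards [hΦ.eventually_eq x] with y hy
    rw [hy, h0, zero_mul]

end Globalization

theorem properSpace_of_finiteDimensional_padic {p : ℕ} [Fact p.Prime] {K : Type*}
    [NontriviallyNormedField K] [Algebra ℚ_[p] K] [FiniteDimensional ℚ_[p] K]
    [ContinuousSMul ℚ_[p] K] : ProperSpace K := by
  let e : K ≃L[ℚ_[p]] (Fin (Module.finrank ℚ_[p] K) → ℚ_[p]) :=
    (Module.finBasis ℚ_[p] K).equivFun.toContinuousLinearEquiv
  have : LocallyCompactSpace K := e.toHomeomorph.isClosedEmbedding.locallyCompactSpace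
  exact ProperSpace.of_locallyCompactSpace K

end PadicZeta

theorem theorem7p1
    -- a `p`-adic field `K` with its normalized absolute value `‖z‖ = |z|_K = q ^ (-ord z)`
    {p : ℕ} [Fact p.Prime]
    {K : Type*} [NontriviallyNormedField K] [IsUltrametricDist K]
    [Algebra ℚ_[p] K] [FiniteDimensional ℚ_[p] K] [ContinuousSMul ℚ_[p] K]
    (π : PadicZeta.RK K) (hπ : Irreducible π)
    (hnorm : ‖(π : K)‖ = (PadicZeta.q K : ℝ)⁻¹)
    -- the Haar measure of `K` that gives `R_K` the measure `1`
    [MeasurableSpace K] [BorelSpace K]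
    (ν : Measure K) [ν.IsAddHaarMeasure] (hν : ν (PadicZeta.RK K : Set K) = 1)
    -- `k = l - 1` series `f_1, …, f_{l-1}` and the series `g = f_l` in `n = m + k` variables
    {m k : ℕ} (hm : 1 ≤ m) (hk : 1 ≤ k)
    (U : Set (Fin (m + k) → K)) (hUo : IsOpen U) (hUc : IsCompact U)
    (f : Fin k → MvPowerSeries (Fin (m + k)) K) (g : MvPowerSeries (Fin (m + k)) K)
    (hf : ∀ i, PadicZeta.ConvergesOn (f i) U) (hg : PadicZeta.ConvergesOn g U)
    -- `V` is a submanifold of dimension `m`, cut out by `f_1, …, f_{l-1}`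
    (V : Set (Fin (m + k) → K)) (hV : V = PadicZeta.zeroLocus f U)
    (hrank : ∀ x ∈ V, (PadicZeta.jacobian f x).rank = k)
    (hg_ne : ∃ x ∈ V, PadicZeta.psum g x ≠ 0) (hg_zero : ∃ x ∈ V, PadicZeta.psum g x = 0)
    -- a Gel'fand–Leray form
    (γ : (Fin (m + k) → K) → (Fin (m + k) → K) [⋀^Fin m]→ₗ[K] K)
    (hγ : PadicZeta.IsGelfandLeray f V γ)
    -- a Bruhat–Schwartz function with support in `U`
    (Φ : (Fin (m + k) → K) → ℂ) (hΦ : IsLocallyConstant Φ) (hΦc : HasCompactSupport Φ)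
    (hΦU : Function.support Φ ⊆ U)
    (ω : Kˣ →ₜ* ℂˣ) (hω : ω ∈ PadicZeta.Omega π 0) :
    IntegrableOn (fun x => Φ x * PadicZeta.quasiVal ω (PadicZeta.psum g x))
      (V \ {x | PadicZeta.psum g x = 0}) (PadicZeta.formMeasure ν V γ) ∧
    (∀ r : ℕ, Integrable (fun x => Φ x * PadicZeta.deltaApprox π r (PadicZeta.pmap f x) *
      PadicZeta.quasiVal ω (PadicZeta.psum g x)) (Measure.pi fun _ => ν)) ∧
    Tendsto (fun r : ℕ => ∫ x, Φ x * PadicZeta.deltaApprox π r (PadicZeta.pmap f x) *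
      PadicZeta.quasiVal ω (PadicZeta.psum g x) ∂(Measure.pi fun _ => ν)) atTop
      (𝓝 (PadicZeta.zetaFun ν Φ ω V g γ)) := by

  have : ProperSpace K := PadicZeta.properSpace_of_finiteDimensional_padic (p := p)
  have hcont := PadicZeta.continuous_mul_quasiVal_psum hπ hnorm hUo hg hΦ hΦU hω
  have hVm : MeasurableSet V := by
    rw [hV]; exact (PadicZeta.isClosed_zeroLocus hUo hUc hf).measurableSet
  -- The support of a locally constant function is already closed, so the compact topological
  -- support lies in `U`.
  have hclosed : IsClosed (Function.support Φ) := (hΦ.isClopen_fiber 0).compl.isClosed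
  have hS : IsCompact (Function.support Φ) := by
    have : IsCompact (closure (Function.support Φ)) := hΦc
    rwa [hclosed.closure_eq] at this
  obtain ⟨W, hSW, hWo, hWc, hWU, hfin, hlim⟩ :=
    PadicZeta.exists_hasDeltaLimit_of_isCompact hπ hnorm hν hUo hUc hf hV hrank hγ hS hΦU
  have hsupp : ∀ x, x ∉ W → Φ x = 0 := fun x hx => by
    by_contra h
    exact hx (hSW h)
  have hcomm : ∀ r x, Φ x * PadicZeta.deltaApprox π r (PadicZeta.pmap f x) *
      PadicZeta.quasiVal ω (PadicZeta.psum g x) =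
      Φ x * PadicZeta.quasiVal ω (PadicZeta.psum g x) *
        PadicZeta.deltaApprox π r (PadicZeta.pmap f x) := fun r x => by ring
  have hint : Integrable (fun x => Φ x * PadicZeta.quasiVal ω (PadicZeta.psum g x))
      (PadicZeta.formMeasure ν V γ) := by
    refine (integrableOn_iff_integrable_of_support_subset (s := W) ?_).1
      (PadicZeta.integrableOn_of_continuous hWc hfin hcont)
    intro x hx
    by_contra hxW
    exact hx (by simp [hsupp x hxW])
  have hzeta : PadicZeta.zetaFun ν Φ ω V g γ =
      ∫ x in W, Φ x * PadicZeta.quasiVal ω (PadicZeta.psum g x) ∂(PadicZeta.formMeasure ν V γ) := by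
    have hVae : (PadicZeta.formMeasure ν V γ).restrict V = PadicZeta.formMeasure ν V γ :=
      Measure.restrict_eq_self_of_ae_mem (PadicZeta.formMeasure_compl hVm)
    have h1 : ∫ x in V \ {x | PadicZeta.psum g x = 0},
        Φ x * PadicZeta.quasiVal ω (PadicZeta.psum g x) ∂(PadicZeta.formMeasure ν V γ) =
        ∫ x in V, Φ x * PadicZeta.quasiVal ω (PadicZeta.psum g x)
          ∂(PadicZeta.formMeasure ν V γ) := by
      -- The integrand vanishes where `f_l` does, so removing these zeros changes nothing, whatever
      -- their measure.
      refine (setIntegral_eq_of_subset_of_forall_sdiff_eq_zero hVm Set.sdiff_subset ?_).symm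
      rintro x ⟨hxV, hx⟩
      have hx0 : PadicZeta.psum g x = 0 := by
        by_contra h
        exact hx ⟨hxV, h⟩
      rw [hx0, PadicZeta.quasiVal_zero, mul_zero]
    unfold PadicZeta.zetaFun
    rw [h1, hVae]
    refine (setIntegral_eq_integral_of_forall_compl_eq_zero fun x hx => ?_).symm
    rw [hsupp x hx, zero_mul]
  refine ⟨hint.integrableOn, fun r => ?_, ?_⟩
  · simp_rw [hcomm]
    refine (integrableOn_iff_integrable_of_support_subset (s := W) ?_).1
      (PadicZeta.integrableOn_mul_deltaApprox hπ hUo hf hWc hWU hcont r)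
    intro x hx
    by_contra hxW
    exact hx (by simp [hsupp x hxW])
  · rw [hzeta]
    refine (hlim _ hcont).congr fun r => ?_
    simp_rw [hcomm]
    refine setIntegral_eq_integral_of_forall_compl_eq_zero fun x hx => ?_
    rw [hsupp x hx, zero_mul, zero_mul]
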